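/- A discounted Markov decision process (DMDP) consists of a finite non-empty set of states $\mathcal S$, a finite non-empty set of actions $\mathcal A_s$ for each state $s$, a transition matrix $P$ whose rows are indexed by the state-action pairs $\mathcal A=\{(s,a): s\in\mathcal S, a\in\mathcal A_s\}$ and are probability distributions $p_a(s)$ on $\mathcal S$, rewards $r_a(s)\in[0,1]$, and a discount factor $\gamma\in[0,1)$. Let $A_{\mathrm{tot}}=|\mathcal A|$, and let $\mathrm{nnz}(P)$ be the number of non-zero entries of $P$. A policy $\pi$ maps each state $s$ to an action $\pi(s)\in\mathcal A_s$; its value is $v^\pi(s_0)=\mathbb E[\sum_{t\ge 0}\gamma^t r_{\pi(s_t)}(s_t)]$, where $s_{t+1}$ is drawn from $p_{\pi(s_t)}(s_t)$, and $v^\star(s_0)=\max_\pi v^\pi(s_0)$. The policy $\pi$ is $\epsilon$-optimal if $v^\pi(s)\ge v^\star(s)-\epsilon$ for all $s$, and $v\in\mathbb R^{\mathcal S}$ is a vector of $\epsilon$-optimal values if $\|v-v^\star\|_\infty\le\epsilon$. Theorem 1.2. There are a randomized algorithm, that is, one fixed program for a real-number random access machine (unit-cost arithmetic and comparisons on reals,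 without rounding; addition, subtraction, halving and comparison of natural numbers used as indices; conversion of natural numbers to reals; unit-cost uniform random draws from $[0,1]$), and constants $C$ and $k$ such that the following holds for every DMDP, every $\epsilon>0$ and every $\delta\in(0,1)$. Given $\gamma,\epsilon,\delta$, the rewards, and $P$ as the list of its non-zero entries ordered by rows, with the rows of each state listed consecutively, the algorithm always halts within $$C\,\bigl(\mathrm{nnz}(P)+A_{\mathrm{tot}}(1-\gamma)^{-2}\bigr)\,\log^k\bigl(2+A_{\mathrm{tot}}+\epsilon^{-1}+(1-\gamma)^{-1}+\delta^{-1}\bigr)$$ operations, and with probability at least $1-\delta$ it outputs both an $\epsilon$-optimal policy and $\epsilon$-optimal values. -/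

import Mathlib

open MeasureTheory

/-! ### Discounted Markov decision processes -/

/-- A tabular discounted Markov decision process with state set `S` and action set `A s` at each
state `s`: `P (s, a)` is the distribution of the next state when action `a` is taken at state `s`,
`r (s, a)` is the reward and `γ` is the discount factor. -/
structure DMDP (S : Type) [Fintype S] (A : S → Type) where
  P : (Σ s, A s) → S → ℝ
  P_nonneg : ∀ q s', 0 ≤ P q s'
  P_sum : ∀ q, ∑ s', P q s' = 1
  r : (Σ s, A s) → ℝ
  r_nonneg : ∀ q, 0 ≤ r q
  r_le_one : ∀ q, r q ≤ 1
  γ : ℝ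
  γ_nonneg : 0 ≤ γ
  γ_lt_one : γ < 1

namespace DMDP

variable {S : Type} [Fintype S] {A : S → Type} [∀ s, Fintype (A s)]

/-- A (deterministic) policy chooses an action at each state. -/
abbrev Policy (_M : DMDP S A) : Type := ∀ s, A s

/-- The law of the state `s_t` in round `t`, when the first state is `s₀` and the agent follows the
policy `π`. -/
noncomputable def stateLaw (M : DMDP S A) (π : M.Policy) (s₀ : S) : ℕ → S → ℝ
  | 0 => open Classical in fun s => if s = s₀ then 1 else 0
  | t + 1 => fun s' => ∑ s, stateLaw M π s₀ t s * M.P ⟨s, π s⟩ s'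

/-- The expected reward that `π` collects in round `t` when started from `s₀`. -/
noncomputable def expectedReward (M : DMDP S A) (π : M.Policy) (s₀ : S) (t : ℕ) : ℝ :=
  ∑ s, M.stateLaw π s₀ t s * M.r ⟨s, π s⟩

/-- The expected discounted reward of `π` from `s₀`; the series converges absolutely, as its terms
lie between `0` and `γ ^ t`. -/
noncomputable def value (M : DMDP S A) (π : M.Policy) (s₀ : S) : ℝ :=
  ∑' t : ℕ, M.γ ^ t * M.expectedReward π s₀ t

/-- The optimal value: the maximum expected discounted reward of any policy, for each initial
state (a maximum over finitely many policies). -/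
noncomputable def optValue (M : DMDP S A) (s₀ : S) : ℝ :=
  ⨆ π : M.Policy, M.value π s₀

/-- `π` is an `ε`-optimal policy: from every initial state, its expected discounted reward is at
least the optimal value minus `ε`. -/
def IsEpsOptimalPolicy (M : DMDP S A) (ε : ℝ) (π : M.Policy) : Prop :=
  ∀ s₀, M.optValue s₀ - ε ≤ M.value π s₀

/-- `v` is an `ε`-optimal value vector: `‖v - v⋆‖ ≤ ε` in the sup norm of `S → ℝ`. -/
def IsEpsOptimalValue (M : DMDP S A) (ε : ℝ) (v : S → ℝ) : Prop :=
  ‖v - M.optValue‖ ≤ ε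

/-- The number of states. -/
noncomputable def numStates (_M : DMDP S A) : ℕ := Fintype.card S

/-- The number `A_tot` of state-action pairs. -/
noncomputable def numPairs (_M : DMDP S A) : ℕ := Fintype.card (Σ s, A s)

/-- The positions of the nonzero entries of the transition matrix. -/
abbrev Nonzeros (M : DMDP S A) : Type := {q : (Σ s, A s) × S // M.P q.1 q.2 ≠ 0}

/-- The number `nnz(P)` of nonzero entries of the transition matrix. -/
noncomputable def nnz (M : DMDP S A) : ℕ := Nat.card M.Nonzeros

end DMDP

/-! ### A randomized real random access machine

The memory consists of arrays of natural numbers (used for indices) and arrays of real numbers. An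
array is named by a number that is fixed in the program, its cells are addressed by computed natural
numbers. The unit-cost operations are: addition, truncated subtraction and halving of natural
numbers, the four arithmetic operations on reals, conversion of a natural number to a real,
comparisons, reading and writing a memory cell, and drawing a uniformly random number in `[0, 1]`.
There is no rounding of reals to integers. A program is a finite piece of syntax. -/

namespace RealRAM

/-- A configuration of the memory; `draws` counts the random numbers drawn so far. -/
structure State where
  nat : ℕ → ℕ → ℕ
  real : ℕ → ℕ → ℝ
  draws : ℕ

/-- Expressions for natural numbers; `get a i` reads cell `i` of array `a`. -/
inductive NExp where
  | lit (k : ℕ)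
  | get (a : ℕ) (i : NExp)
  | add (e f : NExp)
  | sub (e f : NExp)
  | half (e : NExp)

/-- Expressions for real numbers; `get a i` reads cell `i` of array `a`. -/
inductive RExp where
  | ofNat (e : NExp)
  | get (a : ℕ) (i : NExp)
  | add (e f : RExp)
  | sub (e f : RExp)
  | mul (e f : RExp)
  | div (e f : RExp)

/-- Tests. -/
inductive Test where
  | natLe (e f : NExp)
  | realLe (e f : RExp)
  | neg (b : Test)
  | conj (b c : Test)

/-- Programs: `setNat a i e` and `setReal a i e` store the value of `e` in cell `i` of array `a`,
and `draw a i` stores a fresh uniformly random number of `[0, 1]` there. -/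
inductive Prog where
  | skip
  | setNat (a : ℕ) (i : NExp) (e : NExp)
  | setReal (a : ℕ) (i : NExp) (e : RExp)
  | draw (a : ℕ) (i : NExp)
  | seq (p q : Prog)
  | ite (b : Test) (p q : Prog)
  | loop (b : Test) (p : Prog)

namespace NExp

def eval (σ : State) : NExp → ℕ
  | lit k => k
  | get a i => σ.nat a (i.eval σ)
  | add e f => e.eval σ + f.eval σ
  | sub e f => e.eval σ - f.eval σ
  | half e => e.eval σ / 2

/-- The number of operations in an expression. -/
def cost : NExp → ℕ
  | lit _ => 1
  | get _ i => i.cost + 1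
  | add e f => e.cost + f.cost + 1
  | sub e f => e.cost + f.cost + 1
  | half e => e.cost + 1

end NExp

namespace RExp

/-- The value of an expression; a division by zero gives `0`. -/
noncomputable def eval (σ : State) : RExp → ℝ
  | ofNat e => (e.eval σ : ℝ)
  | get a i => σ.real a (i.eval σ)
  | add e f => e.eval σ + f.eval σ
  | sub e f => e.eval σ - f.eval σ
  | mul e f => e.eval σ * f.eval σ
  | div e f => e.eval σ / f.eval σ

/-- The number of operations in an expression. -/
def cost : RExp → ℕ
  | ofNat e => e.cost + 1
  | get _ i => i.cost + 1
  | add e f => e.cost + f.cost + 1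
  | sub e f => e.cost + f.cost + 1
  | mul e f => e.cost + f.cost + 1
  | div e f => e.cost + f.cost + 1

end RExp

namespace Test

/-- The test succeeds in the given memory. -/
def Holds (σ : State) : Test → Prop
  | natLe e f => e.eval σ ≤ f.eval σ
  | realLe e f => e.eval σ ≤ f.eval σ
  | neg b => ¬ b.Holds σ
  | conj b c => b.Holds σ ∧ c.Holds σ

/-- The number of operations in a test. -/
def cost : Test → ℕ
  | natLe e f => e.cost + f.cost + 1
  | realLe e f => e.cost + f.cost + 1
  | neg b => b.cost + 1
  | conj b c => b.cost + c.cost + 1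

end Test

namespace State

/-- Overwrite cell `i` of the array `a` of natural numbers. -/
def writeNat (σ : State) (a i x : ℕ) : State :=
  { σ with nat := Function.update σ.nat a (Function.update (σ.nat a) i x) }

/-- Overwrite cell `i` of the array `a` of real numbers. -/
noncomputable def writeReal (σ : State) (a i : ℕ) (x : ℝ) : State :=
  { σ with real := Function.update σ.real a (Function.update (σ.real a) i x) }

end State

/-- The outcomes of all random draws, in the order in which a run uses them. -/
abbrev Tape : Type := ℕ → unitInterval

/-- The draws are independent and uniformly distributed on `[0, 1]`. -/
noncomputable def tapeMeasure : Measure Tape :=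
  Measure.infinitePi fun _ : ℕ => (volume : Measure unitInterval)

/-- `Exec ω p σ t σ'`: started with memory `σ`, and with random draws `ω`, the program `p` halts
after `t` operations with memory `σ'`. -/
inductive Exec (ω : Tape) : Prog → State → ℕ → State → Prop
  | skip (σ : State) : Exec ω Prog.skip σ 1 σ
  | setNat (a : ℕ) (i e : NExp) (σ : State) :
      Exec ω (Prog.setNat a i e) σ (i.cost + e.cost + 1) (σ.writeNat a (i.eval σ) (e.eval σ))
  | setReal (a : ℕ) (i : NExp) (e : RExp) (σ : State) :
      Exec ω (Prog.setReal a i e) σ (i.cost + e.cost + 1) (σ.writeReal a (i.eval σ) (e.eval σ))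
  | draw (a : ℕ) (i : NExp) (σ : State) :
      Exec ω (Prog.draw a i) σ (i.cost + 1)
        { σ.writeReal a (i.eval σ) (ω σ.draws : ℝ) with draws := σ.draws + 1 }
  | seq {p q : Prog} {σ σ' σ'' : State} {t t' : ℕ} :
      Exec ω p σ t σ' → Exec ω q σ' t' σ'' → Exec ω (Prog.seq p q) σ (t + t') σ''
  | ite_true {b : Test} {p q : Prog} {σ σ' : State} {t : ℕ} :
      b.Holds σ → Exec ω p σ t σ' → Exec ω (Prog.ite b p q) σ (b.cost + t) σ'
  | ite_false {b : Test} {p q : Prog} {σ σ' : State} {t : ℕ} :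
      ¬ b.Holds σ → Exec ω q σ t σ' → Exec ω (Prog.ite b p q) σ (b.cost + t) σ'
  | loop_true {b : Test} {p : Prog} {σ σ' σ'' : State} {t t' : ℕ} :
      b.Holds σ → Exec ω p σ t σ' → Exec ω (Prog.loop b p) σ' t' σ'' →
      Exec ω (Prog.loop b p) σ (b.cost + t + t') σ''
  | loop_false {b : Test} {p : Prog} {σ : State} :
      ¬ b.Holds σ → Exec ω (Prog.loop b p) σ b.cost σ

end RealRAM

/-! ### Input and output of an algorithm in the offline setting -/

namespace DMDP

variable {S : Type} [Fintype S] {A : S → Type} [∀ s, Fintype (A s)]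

/-- A numbering, from `0` on, of the states, the state-action pairs and the nonzero entries of the
transition matrix, in which the pairs are grouped by their state, and the entries by their row. -/
structure Numbering (M : DMDP S A) where
  state : Fin M.numStates ≃ S
  pair : Fin M.numPairs ≃ Σ s, A s
  entry : Fin M.nnz ≃ M.Nonzeros
  pair_sorted : Monotone fun j => state.symm (pair j).1
  entry_sorted : Monotone fun e => pair.symm (entry e).1.1

namespace Numbering

variable {M : DMDP S A}

/-- The initial memory of the machine. The transition matrix is given as the list of its nonzero
entries with their rows and columns. All cells that do not hold the input are `0`.
* natural-number array `0`: the numbers of states, of state-action pairs and of nonzero entries;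
* natural-number array `1`: the state of each state-action pair;
* natural-number arrays `2` and `3`: the row (a pair) and the column (a state) of each nonzero entry;
* real array `0`: `γ`, `ε` and `δ`;
* real array `1`: the reward of each state-action pair;
* real array `2`: the nonzero entries themselves. -/
noncomputable def input (I : M.Numbering) (ε δ : ℝ) : RealRAM.State where
  nat
    | 0, 0 => M.numStates
    | 0, 1 => M.numPairs
    | 0, 2 => M.nnz
    | 1, j => if h : j < M.numPairs then I.state.symm (I.pair ⟨j, h⟩).1 else 0
    | 2, e => if h : e < M.nnz then I.pair.symm (I.entry ⟨e, h⟩).1.1 else 0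
    | 3, e => if h : e < M.nnz then I.state.symm (I.entry ⟨e, h⟩).1.2 else 0
    | _, _ => 0
  real
    | 0, 0 => M.γ
    | 0, 1 => ε
    | 0, 2 => δ
    | 1, j => if h : j < M.numPairs then M.r (I.pair ⟨j, h⟩) else 0
    | 2, e => if h : e < M.nnz then M.P (I.entry ⟨e, h⟩).1.1 (I.entry ⟨e, h⟩).1.2 else 0
    | _, _ => 0
  draws := 0

/-- The final memory holds an `ε`-optimal policy, in natural-number array `4` (for each state, the
number of the state-action pair that is chosen there), and `ε`-optimal values, in real array `3`. -/
def IsEpsOptimalOutput (I : M.Numbering) (ε : ℝ) (σ : RealRAM.State) : Prop :=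
  (∃ π : M.Policy, M.IsEpsOptimalPolicy ε π ∧
    ∀ s, σ.nat 4 (I.state.symm s) = I.pair.symm ⟨s, π s⟩) ∧
  M.IsEpsOptimalValue ε fun s => σ.real 3 (I.state.symm s)

end Numbering

end DMDP

/-! The algorithm is value iteration with variance reduction and truncated steps. Let `N` be the
least natural number with `1 ≤ N * (1 - γ)`. The optimal values solve the Bellman equation and lie
between `0` and `N`, so the zero vector has error at most `N`. Each of `K` epochs halves the error,
leaving `N / 2 ^ K`. A policy that is greedy for values with error `α` loses at most `2 * α / (1 -
γ)`, so `2 ^ K ≥ 2 * N ^ 2 / ε` suffices for both outputs (`optValue_bellman`,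
`isEpsOptimalPolicy_of_greedy`).

An epoch starts by computing the product `x = P v` exactly, in time proportional to `nnz + A_tot`.
In each of the next `L = 2 * N * m` rounds, every value moves by its Bellman update clamped to `[-h,
h]`. Instead of recomputing `P v`, the round adds to `x j` the change of value at one sampled
successor of the pair `j`. The sample is unbiased (`integral_sample`), so `x j - (P v) j` is a
martingale, and the truncation bounds the sampled changes by `h`. By Azuma–Hoeffding it stays below
`m * h` through the epoch once `m` is of order `N` times a logarithm (`measure_error_le`). One draw
per round serves all pairs, because the union bound over pairs needs no independence between them.

If the estimates are that accurate, the error falls by `h` in each round, from `4 * N * m * h` to `2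
* N * m * h` (`abs_rounds_sub_le`): as long as it is that large, the contraction by `γ ≤ 1 - 1 / N`
outweighs the noise `m * h`. The next epoch uses half the width. With `m = 8 * N * c` there are `16
* N ^ 2 * c` rounds per epoch, each costing `A_tot` times a logarithm; here `K`, `c` and the depth
of the bisection are logarithmic (`exists_isParam`).

The program is verified for every fixed tape: its memory follows the functions `rounds` and `epochs`
of the tape (`runs_mainProg`), and its parameters depend on the input only. Hence the time bound is
deterministic, and probability enters only through the accuracy of the estimates. -/

namespace RealRAM

/-! ### Memory updates and a program logic with running times -/

@[simp] theorem State.writeNat_nat (σ : State) (a i x b j : ℕ) :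
    (σ.writeNat a i x).nat b j = if b = a then (if j = i then x else σ.nat a j) else σ.nat b j := by
  simp only [State.writeNat, Function.update_apply]
  split_ifs <;> simp_all

@[simp] theorem State.writeNat_real (σ : State) (a i x : ℕ) :
    (σ.writeNat a i x).real = σ.real := rfl

@[simp] theorem State.writeNat_draws (σ : State) (a i x : ℕ) :
    (σ.writeNat a i x).draws = σ.draws := rfl

@[simp] theorem State.writeReal_real (σ : State) (a i : ℕ) (x : ℝ) (b j : ℕ) :
    (σ.writeReal a i x).real b j =
      if b = a then (if j = i then x else σ.real a j) else σ.real b j := by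
  simp only [State.writeReal, Function.update_apply]
  split_ifs <;> simp_all

@[simp] theorem State.writeReal_nat (σ : State) (a i : ℕ) (x : ℝ) :
    (σ.writeReal a i x).nat = σ.nat := rfl

@[simp] theorem State.writeReal_draws (σ : State) (a i : ℕ) (x : ℝ) :
    (σ.writeReal a i x).draws = σ.draws := rfl

namespace Prog

/-- Whether the program contains a write to the array `a` of natural numbers. -/
def writesNat (a : ℕ) : Prog → Bool
  | skip => false
  | setNat b _ _ => b == a
  | setReal _ _ _ => false
  | draw _ _ => false
  | seq p q => p.writesNat a || q.writesNat a
  | ite _ p q => p.writesNat a || q.writesNat a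
  | loop _ p => p.writesNat a

/-- Whether the program contains a write to the array `a` of real numbers. -/
def writesReal (a : ℕ) : Prog → Bool
  | skip => false
  | setNat _ _ _ => false
  | setReal b _ _ => b == a
  | draw b _ => b == a
  | seq p q => p.writesReal a || q.writesReal a
  | ite _ p q => p.writesReal a || q.writesReal a
  | loop _ p => p.writesReal a

/-- Whether the program contains a random draw. -/
def draws : Prog → Bool
  | skip => false
  | setNat _ _ _ => false
  | setReal _ _ _ => false
  | draw _ _ => true
  | seq p q => p.draws || q.draws
  | ite _ p q => p.draws || q.draws
  | loop _ p => p.draws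

/-- An upper bound for the running time of a loop-free program. -/
def cost : Prog → ℕ
  | skip => 1
  | setNat _ i e => i.cost + e.cost + 1
  | setReal _ i e => i.cost + e.cost + 1
  | draw _ i => i.cost + 1
  | seq p q => p.cost + q.cost
  | ite b p q => b.cost + (p.cost + q.cost)
  | loop _ _ => 0

/-- The weakest precondition of a loop-free program. -/
def wp (ω : Tape) : Prog → (State → Prop) → State → Prop
  | skip, Q, σ => Q σ
  | setNat a i e, Q, σ => Q (σ.writeNat a (i.eval σ) (e.eval σ))
  | setReal a i e, Q, σ => Q (σ.writeReal a (i.eval σ) (e.eval σ))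
  | draw a i, Q, σ => Q { σ.writeReal a (i.eval σ) (ω σ.draws : ℝ) with draws := σ.draws + 1 }
  | seq p q, Q, σ => p.wp ω (q.wp ω Q) σ
  | ite b p q, Q, σ => (b.Holds σ → p.wp ω Q σ) ∧ (¬ b.Holds σ → q.wp ω Q σ)
  | loop _ _, _, _ => False

end Prog

variable {ω : Tape} {p q : Prog} {σ σ' : State} {t T T' : ℕ} {Q R : State → Prop}

/-- A syntactic frame rule: `writesNat` computes, so for a concrete program the hypothesis is closed
by `rfl` or `decide`. -/
theorem Exec.nat_eq (h : Exec ω p σ t σ') {a : ℕ} (ha : p.writesNat a = false) :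
    σ'.nat a = σ.nat a := by
  induction h with
  | setNat b i e σ =>
    funext j
    have : a ≠ b := by rintro rfl; simp [Prog.writesNat] at ha
    simp [this]
  | seq _ _ h1 h2 =>
    simp only [Prog.writesNat, Bool.or_eq_false_iff] at ha
    rw [h2 ha.2, h1 ha.1]
  | ite_true _ _ h1 =>
    simp only [Prog.writesNat, Bool.or_eq_false_iff] at ha
    exact h1 ha.1
  | ite_false _ _ h1 =>
    simp only [Prog.writesNat, Bool.or_eq_false_iff] at ha
    exact h1 ha.2
  | loop_true _ _ _ h1 h2 => rw [h2 ha, h1 ha]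
  | _ => rfl

theorem Exec.real_eq (h : Exec ω p σ t σ') {a : ℕ} (ha : p.writesReal a = false) :
    σ'.real a = σ.real a := by
  induction h with
  | setReal b i e σ =>
    funext j
    have : a ≠ b := by rintro rfl; simp [Prog.writesReal] at ha
    simp [this]
  | draw b i σ =>
    funext j
    have : a ≠ b := by rintro rfl; simp [Prog.writesReal] at ha
    simp [this]
  | seq _ _ h1 h2 =>
    simp only [Prog.writesReal, Bool.or_eq_false_iff] at ha
    rw [h2 ha.2, h1 ha.1]
  | ite_true _ _ h1 =>
    simp only [Prog.writesReal, Bool.or_eq_false_iff] at ha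
    exact h1 ha.1
  | ite_false _ _ h1 =>
    simp only [Prog.writesReal, Bool.or_eq_false_iff] at ha
    exact h1 ha.2
  | loop_true _ _ _ h1 h2 => rw [h2 ha, h1 ha]
  | _ => rfl

theorem Exec.draws_eq (h : Exec ω p σ t σ') (ha : p.draws = false) :
    σ'.draws = σ.draws := by
  induction h with
  | draw b i σ => simp [Prog.draws] at ha
  | seq _ _ h1 h2 =>
    simp only [Prog.draws, Bool.or_eq_false_iff] at ha
    rw [h2 ha.2, h1 ha.1]
  | ite_true _ _ h1 =>
    simp only [Prog.draws, Bool.or_eq_false_iff] at ha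
    exact h1 ha.1
  | ite_false _ _ h1 =>
    simp only [Prog.draws, Bool.or_eq_false_iff] at ha
    exact h1 ha.2
  | loop_true _ _ _ h1 h2 => rw [h2 ha, h1 ha]
  | _ => rfl

/-- The memories `σ` and `σ'` differ at most in what the program `p` may write. -/
structure Frame (p : Prog) (σ σ' : State) : Prop where
  nat : ∀ a, p.writesNat a = false → σ'.nat a = σ.nat a
  real : ∀ a, p.writesReal a = false → σ'.real a = σ.real a
  draws : p.draws = false → σ'.draws = σ.draws

/-- Started with memory `σ`, the program `p` halts within `T` operations, with a memory that
satisfies `Q`. -/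
def Runs (ω : Tape) (p : Prog) (σ : State) (T : ℕ) (Q : State → Prop) : Prop :=
  ∃ t σ', Exec ω p σ t σ' ∧ t ≤ T ∧ Q σ'

theorem Runs.frame (h : Runs ω p σ T Q) : Runs ω p σ T fun σ' => Q σ' ∧ Frame p σ σ' := by
  obtain ⟨t, σ', he, ht, hQ⟩ := h
  exact ⟨t, σ', he, ht, hQ, fun _ => he.nat_eq, fun _ => he.real_eq, he.draws_eq⟩

theorem Runs.mono (h : Runs ω p σ T Q) (hT : T ≤ T') (hQ : ∀ σ', Frame p σ σ' → Q σ' → R σ') :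
    Runs ω p σ T' R := by
  obtain ⟨t, σ', he, ht, hR, hF⟩ := h.frame
  exact ⟨t, σ', he, ht.trans hT, hQ σ' hF hR⟩

theorem Runs.seq (h : Runs ω p σ T fun σ' => Runs ω q σ' T' Q) :
    Runs ω (p.seq q) σ (T + T') Q := by
  obtain ⟨t, σ', he, ht, t', σ'', he', ht', hQ⟩ := h
  exact ⟨t + t', σ'', .seq he he', by omega, hQ⟩

theorem Runs.of_wp {p : Prog} {σ : State} {Q : State → Prop} (h : p.wp ω Q σ) :
    Runs ω p σ p.cost Q := by
  induction p generalizing σ Q with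
  | skip => exact ⟨_, _, .skip σ, le_rfl, h⟩
  | setNat a i e => exact ⟨_, _, .setNat a i e σ, le_rfl, h⟩
  | setReal a i e => exact ⟨_, _, .setReal a i e σ, le_rfl, h⟩
  | draw a i => exact ⟨_, _, .draw a i σ, le_rfl, h⟩
  | seq p q hp hq => exact ((hp h).mono le_rfl fun _ _ => hq).seq
  | ite b p q hp hq =>
    by_cases hb : b.Holds σ
    · obtain ⟨t, σ', he, ht, hQ⟩ := hp (h.1 hb)
      exact ⟨_, σ', .ite_true hb he, by simp only [Prog.cost]; omega, hQ⟩
    · obtain ⟨t, σ', he, ht, hQ⟩ := hq (h.2 hb)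
      exact ⟨_, σ', .ite_false hb he, by simp only [Prog.cost]; omega, hQ⟩
  | loop b p => exact h.elim

/-- The rule for a loop whose number `n` of iterations is known. -/
theorem Runs.loop {b : Test} {p : Prog} {σ : State} (Inv : ℕ → State → Prop) (n T : ℕ)
    (h0 : Inv 0 σ) (hcont : ∀ i < n, ∀ σ, Inv i σ → b.Holds σ)
    (hdone : ∀ σ, Inv n σ → ¬ b.Holds σ)
    (hbody : ∀ i < n, ∀ σ, Inv i σ → Runs ω p σ T (Inv (i + 1))) :
    Runs ω (Prog.loop b p) σ (n * (b.cost + T) + b.cost) (Inv n) := by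
  -- Induction on the number `k` of iterations that remain, since `Exec.loop_true` peels off the
  -- first one.
  suffices H : ∀ k i, i + k = n → ∀ σ, Inv i σ →
      Runs ω (Prog.loop b p) σ (k * (b.cost + T) + b.cost) (Inv n) from H n 0 (by simp) σ h0
  intro k
  induction k with
  | zero =>
    rintro i rfl σ hσ
    exact ⟨_, σ, .loop_false (hdone σ hσ), by simp, hσ⟩
  | succ k ih =>
    rintro i hi σ hσ
    obtain ⟨t, σ', he, ht, hσ'⟩ := hbody i (by omega) σ hσ
    obtain ⟨t', σ'', he', ht', hQ⟩ := ih (i + 1) (by omega) σ' hσ'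
    refine ⟨_, σ'', .loop_true (hcont i (by omega) σ hσ) he he', ?_, hQ⟩
    nlinarith

/-- `forLoop c n p` runs `p` for the values `0, 1, …, n - 1` of the counter, which is held in cell
`0` of the array `c` of natural numbers. -/
def forLoop (c : ℕ) (n : RExp) (p : Prog) : Prog :=
  .seq (.setNat c (.lit 0) (.lit 0))
    -- The bound is a real expression because the numbers of rounds and epochs are computed in real
    -- cells, and the machine cannot convert a real to a natural number.
    (.loop (.neg (.realLe n (.ofNat (.get c (.lit 0)))))
      (.seq p (.setNat c (.lit 0) (.add (.get c (.lit 0)) (.lit 1)))))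

/-- `Inv` may speak of the whole memory, counter included, so the body has to establish it for the
memory after the increment. -/
theorem Runs.forLoop {c : ℕ} {n : RExp} {p : Prog} {σ : State} (Inv : ℕ → State → Prop) (k T : ℕ)
    (hc : p.writesNat c = false)
    (hn : ∀ i σ, Inv i σ → n.eval σ = k)
    (h0 : Inv 0 (σ.writeNat c 0 0))
    (hbody : ∀ i < k, ∀ σ, Inv i σ → σ.nat c 0 = i →
      Runs ω p σ T fun σ' => Inv (i + 1) (σ'.writeNat c 0 (i + 1))) :
    Runs ω (RealRAM.forLoop c n p) σ (k * (n.cost + T + 11) + (n.cost + 8)) (Inv k) := by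
  have h1 : Runs ω (Prog.setNat c (.lit 0) (.lit 0)) σ 3
      fun σ' => Inv 0 σ' ∧ σ'.nat c 0 = 0 :=
    Runs.of_wp (by simpa [Prog.wp, NExp.eval] using h0)
  have h2 : Runs ω (RealRAM.forLoop c n p) σ (3 + (k * ((n.cost + 5) + (T + 6)) + (n.cost + 5)))
      fun σ' => Inv k σ' ∧ σ'.nat c 0 = k := by
    refine Runs.seq (h1.mono le_rfl fun σ' _ hσ' => ?_)
    refine (Runs.loop (fun i σ => Inv i σ ∧ σ.nat c 0 = i) k (T + 6) hσ' ?_ ?_ ?_).mono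
      (by simp [Test.cost, RExp.cost, NExp.cost]) fun _ _ h => h
    · rintro i hi σ ⟨hσ, hi'⟩
      simp [Test.Holds, hn i σ hσ, RExp.eval, NExp.eval, hi', hi]
    · rintro σ ⟨hσ, hi'⟩
      simp [Test.Holds, hn k σ hσ, RExp.eval, NExp.eval, hi']
    · rintro i hi σ ⟨hσ, hi'⟩
      refine Runs.seq ((hbody i hi σ hσ hi').mono le_rfl fun σ' hF hσ' => ?_)
      have hc' : σ'.nat c 0 = i := by rw [hF.nat c hc, hi']
      refine (Runs.of_wp (Q := fun σ => Inv (i + 1) σ ∧ σ.nat c 0 = i + 1) ?_).mono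
        (by simp [Prog.cost, NExp.cost]) fun _ _ h => h
      simpa [Prog.wp, NExp.eval, hc'] using hσ'
  exact h2.mono (by nlinarith) fun _ _ h => h.1

end RealRAM

/-! ### The Bellman equation and greedy policies -/

namespace DMDP

section Bellman

variable {S : Type} [Fintype S] {A : S → Type} (M : DMDP S A)

/-- The expected total reward of a state-action pair when the next state is worth `v`. -/
noncomputable def qValue (v : S → ℝ) (q : Σ s, A s) : ℝ := M.r q + M.γ * ∑ s', M.P q s' * v s'

theorem stateLaw_nonneg (π : M.Policy) (s₀ : S) (t : ℕ) (s : S) : 0 ≤ M.stateLaw π s₀ t s := by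
  induction t generalizing s with
  | zero => simp only [stateLaw]; split_ifs <;> norm_num
  | succ t ih => exact Finset.sum_nonneg fun s' _ => mul_nonneg (ih s') (M.P_nonneg _ _)

theorem sum_stateLaw (π : M.Policy) (s₀ : S) (t : ℕ) : ∑ s, M.stateLaw π s₀ t s = 1 := by
  classical
  induction t with
  | zero => simp [stateLaw]
  | succ t ih =>
    simp only [stateLaw]
    rw [Finset.sum_comm]
    simp [← Finset.mul_sum, M.P_sum, ih]

/-- `stateLaw` appends steps at the end, whereas the Bellman equation conditions on the first step.
-/
theorem stateLaw_succ_left (π : M.Policy) (s₀ : S) (t : ℕ) (s : S) :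
    M.stateLaw π s₀ (t + 1) s = ∑ s₁, M.P ⟨s₀, π s₀⟩ s₁ * M.stateLaw π s₁ t s := by
  classical
  induction t generalizing s with
  | zero => simp [stateLaw]
  | succ t ih =>
    rw [stateLaw]
    simp_rw [ih, Finset.sum_mul]
    rw [Finset.sum_comm]
    refine Finset.sum_congr rfl fun s₁ _ => ?_
    simp_rw [stateLaw, Finset.mul_sum, mul_assoc]

theorem expectedReward_nonneg (π : M.Policy) (s₀ : S) (t : ℕ) : 0 ≤ M.expectedReward π s₀ t :=
  Finset.sum_nonneg fun s _ => mul_nonneg (M.stateLaw_nonneg π s₀ t s) (M.r_nonneg _)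

theorem expectedReward_le_one (π : M.Policy) (s₀ : S) (t : ℕ) : M.expectedReward π s₀ t ≤ 1 := by
  rw [← M.sum_stateLaw π s₀ t]
  exact Finset.sum_le_sum fun s _ =>
    mul_le_of_le_one_right (M.stateLaw_nonneg π s₀ t s) (M.r_le_one _)

theorem summable_value (π : M.Policy) (s₀ : S) :
    Summable fun t : ℕ => M.γ ^ t * M.expectedReward π s₀ t :=
  (summable_geometric_of_lt_one M.γ_nonneg M.γ_lt_one).of_nonneg_of_le
    (fun t => mul_nonneg (pow_nonneg M.γ_nonneg t) (M.expectedReward_nonneg π s₀ t))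
    fun t => mul_le_of_le_one_right (pow_nonneg M.γ_nonneg t) (M.expectedReward_le_one π s₀ t)

theorem value_eq_qValue (π : M.Policy) (s : S) :
    M.value π s = M.qValue (M.value π) ⟨s, π s⟩ := by
  classical
  have h : ∀ t, M.γ ^ (t + 1) * M.expectedReward π s (t + 1) =
      M.γ * ∑ s₁, M.P ⟨s, π s⟩ s₁ * (M.γ ^ t * M.expectedReward π s₁ t) := by
    intro t
    simp only [expectedReward, stateLaw_succ_left, Finset.sum_mul]
    rw [Finset.sum_comm, pow_succ', mul_assoc, Finset.mul_sum]
    congr 1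
    refine Finset.sum_congr rfl fun s₁ _ => ?_
    simp_rw [Finset.mul_sum]
    exact Finset.sum_congr rfl fun s₂ _ => by ring
  rw [value, (M.summable_value π s).tsum_eq_zero_add, qValue]
  congr 1
  · simp [expectedReward, stateLaw]
  · simp_rw [h]
    rw [tsum_mul_left, Summable.tsum_finsetSum fun s₁ _ => (M.summable_value π s₁).mul_left _]
    simp_rw [tsum_mul_left]
    rfl

/-- A discounted maximum principle. -/
theorem le_of_le_add_discounted {w : S → ℝ} {c : ℝ} (π : M.Policy)
    (h : ∀ s, w s ≤ c + M.γ * ∑ s', M.P ⟨s, π s⟩ s' * w s') (s : S) : w s ≤ c / (1 - M.γ) := by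
  -- At a maximiser `m` the average of `w` is at most `w m`, so `w m ≤ c + γ * w m`.
  obtain ⟨m, -, hm⟩ := Finset.exists_max_image Finset.univ w ⟨s, Finset.mem_univ s⟩
  have h1 : ∑ s', M.P ⟨m, π m⟩ s' * w s' ≤ w m := by
    calc _ ≤ ∑ s', M.P ⟨m, π m⟩ s' * w m := Finset.sum_le_sum fun s' _ =>
          mul_le_mul_of_nonneg_left (hm s' (Finset.mem_univ _)) (M.P_nonneg _ _)
      _ = w m := by rw [← Finset.sum_mul, M.P_sum, one_mul]
  have h2 := h m
  have h3 := mul_le_mul_of_nonneg_left h1 M.γ_nonneg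
  refine (hm s (Finset.mem_univ s)).trans ?_
  rw [le_div_iff₀ (by linarith [M.γ_lt_one])]
  linarith

theorem qValue_sub_le {v w : S → ℝ} {c : ℝ} (h : ∀ s, v s - w s ≤ c) (q : Σ s, A s) :
    M.qValue v q - M.qValue w q ≤ M.γ * c := by
  have : ∑ s', M.P q s' * v s' - ∑ s', M.P q s' * w s' ≤ c := by
    rw [← Finset.sum_sub_distrib]
    calc _ ≤ ∑ s', M.P q s' * c := Finset.sum_le_sum fun s' _ => by
          rw [← mul_sub]; exact mul_le_mul_of_nonneg_left (h s') (M.P_nonneg _ _)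
      _ = c := by rw [← Finset.sum_mul, M.P_sum, one_mul]
  have h3 := mul_le_mul_of_nonneg_left this M.γ_nonneg
  simp only [qValue]
  linarith

/-- The Bellman operator is a `γ`-contraction in the sup norm; Banach's theorem gives a fixed point,
and `π` picks maximising actions. -/
theorem exists_bellman_solution [∀ s, Fintype (A s)] [∀ s, Nonempty (A s)] :
    ∃ (u : S → ℝ) (π : M.Policy), (∀ s, u s = M.qValue u ⟨s, π s⟩) ∧
      ∀ s a, M.qValue u ⟨s, a⟩ ≤ u s := by
  let B : (S → ℝ) → S → ℝ := fun v s =>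
    Finset.univ.sup' Finset.univ_nonempty fun a : A s => M.qValue v ⟨s, a⟩
  have hle : ∀ v w : S → ℝ, ∀ s, B v s ≤ B w s + M.γ * dist v w := by
    intro v w s
    refine Finset.sup'_le _ _ fun a _ => ?_
    have h1 := M.qValue_sub_le (v := v) (w := w) (c := dist v w)
      (fun s => (le_abs_self _).trans (dist_le_pi_dist v w s)) ⟨s, a⟩
    have h2 := Finset.le_sup' (fun a : A s => M.qValue w ⟨s, a⟩) (Finset.mem_univ a)
    simp only [B]
    linarith
  have hB : ContractingWith M.γ.toNNReal B := by
    refine ⟨by simpa using M.γ_lt_one, LipschitzWith.of_dist_le_mul fun v w => ?_⟩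
    refine (dist_pi_le_iff (by positivity)).2 fun s => ?_
    rw [Real.dist_eq, abs_sub_le_iff]
    have h1 := hle v w s
    have h2 := hle w v s
    rw [dist_comm w v] at h2
    rw [Real.coe_toNNReal _ M.γ_nonneg]
    constructor <;> linarith
  obtain ⟨u, hu⟩ : ∃ u, B u = u := ⟨_, hB.fixedPoint_isFixedPt⟩
  have h : ∀ s, ∃ a : A s, u s = M.qValue u ⟨s, a⟩ := fun s => by
    obtain ⟨a, -, ha⟩ := Finset.exists_mem_eq_sup' Finset.univ_nonempty
      fun a : A s => M.qValue u ⟨s, a⟩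
    exact ⟨a, by rw [← ha]; exact (congrFun hu s).symm⟩
  choose π hπ using h
  refine ⟨u, π, hπ, fun s a => ?_⟩
  rw [← congrFun hu s]
  exact Finset.le_sup' (fun a : A s => M.qValue u ⟨s, a⟩) (Finset.mem_univ a)

/-- The maximum principle, applied to differences of values, shows that a Bellman solution dominates
the value of every policy and is attained by its own greedy policy. Hence it is `optValue`. -/
theorem optValue_bellman [∀ s, Fintype (A s)] [∀ s, Nonempty (A s)] :
    ∃ π : M.Policy, (∀ s, M.optValue s = M.qValue M.optValue ⟨s, π s⟩) ∧
      ∀ s a, M.qValue M.optValue ⟨s, a⟩ ≤ M.optValue s := by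
  obtain ⟨u, π, hπ, hu⟩ := M.exists_bellman_solution
  have hsub : ∀ (v w : S → ℝ) q, M.qValue v q - M.qValue w q =
      0 + M.γ * ∑ s', M.P q s' * (v s' - w s') := fun v w q => by
    simp only [qValue, mul_sub, Finset.sum_sub_distrib]; ring
  have h1 : ∀ π' s, M.value π' s ≤ u s := fun π' s => by
    have := M.le_of_le_add_discounted (w := fun s => M.value π' s - u s) (c := 0) π'
      (fun s => by rw [← hsub, ← M.value_eq_qValue]; linarith [hu s (π' s)]) s
    rw [zero_div] at this
    linarith
  have h2 : ∀ s, u s ≤ M.value π s := fun s => by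
    have := M.le_of_le_add_discounted (w := fun s => u s - M.value π s) (c := 0) π
      (fun s => by rw [← hsub, ← M.value_eq_qValue, ← hπ]) s
    rw [zero_div] at this
    linarith
  have : M.optValue = u := funext fun s =>
    haveI : Nonempty M.Policy := ⟨π⟩
    le_antisymm (ciSup_le fun π' => h1 π' s)
      ((h2 s).trans (le_ciSup (f := fun π => M.value π s) (Set.finite_range _).bddAbove π))
  rw [this]
  exact ⟨π, hπ, hu⟩

theorem optValue_nonneg [∀ s, Fintype (A s)] [∀ s, Nonempty (A s)] (s : S) : 0 ≤ M.optValue s := by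
  obtain ⟨π, hπ, -⟩ := M.optValue_bellman
  have := M.le_of_le_add_discounted (w := fun s => - M.optValue s) (c := 0) π (fun s => by
    have h := hπ s
    simp only [qValue] at h
    simp only [mul_neg, Finset.sum_neg_distrib]
    linarith [M.r_nonneg ⟨s, π s⟩]) s
  rw [zero_div] at this
  linarith

theorem optValue_le [∀ s, Fintype (A s)] [∀ s, Nonempty (A s)] (s : S) : M.optValue s ≤ 1 / (1 - M.γ) := by
  obtain ⟨π, hπ, -⟩ := M.optValue_bellman
  exact M.le_of_le_add_discounted π (fun s => by
    have h := hπ s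
    simp only [qValue] at h
    linarith [M.r_le_one ⟨s, π s⟩]) s

/-- A policy that is greedy for an approximation `v` of the optimal values is nearly optimal. -/
theorem isEpsOptimalPolicy_of_greedy [∀ s, Fintype (A s)] [∀ s, Nonempty (A s)] {v : S → ℝ} {α ε : ℝ}
    (hv : ∀ s, |v s - M.optValue s| ≤ α) (hα : 2 * α ≤ ε * (1 - M.γ)) (π : M.Policy)
    (hπ : ∀ s a, M.qValue v ⟨s, a⟩ ≤ M.qValue v ⟨s, π s⟩) : M.IsEpsOptimalPolicy ε π := by
  intro s
  have hα0 : 0 ≤ α := (abs_nonneg _).trans (hv s)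
  obtain ⟨π', hπ', -⟩ := M.optValue_bellman
  -- Passing from `optValue` to `v` at the optimal action, and back at the greedy action, costs at
  -- most `γ * α ≤ α` each time; greediness compares the two actions under `v`.
  have := M.le_of_le_add_discounted (w := fun s => M.optValue s - M.value π s)
    (c := 2 * α) π (fun s => by
      have h1 := M.qValue_sub_le (v := M.optValue) (w := v) (c := α)
        (fun s => (le_abs_self _).trans (abs_sub_comm (v s) _ ▸ hv s)) ⟨s, π' s⟩
      have h2 := M.qValue_sub_le (v := v) (w := M.optValue) (c := α)
        (fun s => (le_abs_self _).trans (hv s)) ⟨s, π s⟩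
      have h3 := hπ s (π' s)
      have h4 : M.γ * α ≤ α := mul_le_of_le_one_left hα0 M.γ_lt_one.le
      rw [hπ' s, M.value_eq_qValue π s]
      simp only [mul_sub, Finset.sum_sub_distrib]
      simp only [qValue] at *
      linarith) s
  have h5 : 2 * α / (1 - M.γ) ≤ ε := by
    rwa [div_le_iff₀ (by linarith [M.γ_lt_one])]
  linarith

end Bellman

end DMDP

/-- A discounted Markov decision process whose states, state-action pairs and transitions are
numbered, with the transitions sorted by their pair. -/
structure TabularMDP where
  numStates : ℕ
  numPairs : ℕ
  numEntries : ℕ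
  st : ℕ → ℕ
  row : ℕ → ℕ
  col : ℕ → ℕ
  r : ℕ → ℝ
  P : ℕ → ℝ
  γ : ℝ
  st_lt : ∀ j < numPairs, st j < numStates
  row_lt : ∀ e < numEntries, row e < numPairs
  col_lt : ∀ e < numEntries, col e < numStates
  row_mono : ∀ e e', e ≤ e' → e' < numEntries → row e ≤ row e'
  P_nonneg : ∀ e < numEntries, 0 ≤ P e
  row_sum : ∀ j < numPairs, ∑ e ∈ Finset.range numEntries with row e = j, P e = 1
  γ_nonneg : 0 ≤ γ
  γ_lt_one : γ < 1

namespace TabularMDP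

variable (D : TabularMDP)

/-- The expected value of the next state after the pair number `j`. -/
noncomputable def next (v : ℕ → ℝ) (j : ℕ) : ℝ :=
  ∑ e ∈ Finset.range D.numEntries with D.row e = j, D.P e * v (D.col e)

/-- The Bellman equation for the optimal values. -/
def IsOptimal (u : ℕ → ℝ) : Prop :=
  ∀ s < D.numStates, (∀ j < D.numPairs, D.st j = s → D.r j + D.γ * D.next u j ≤ u s) ∧
    ∃ j < D.numPairs, D.st j = s ∧ u s = D.r j + D.γ * D.next u j

end TabularMDP

/-! ### Translation of a process into numbered arrays -/

namespace DMDP.Numbering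

variable {S : Type} [Fintype S] {A : S → Type} [∀ s, Fintype (A s)] {M : DMDP S A}
  (I : M.Numbering)

/-- The state of a pair, by number. -/
noncomputable def st (j : ℕ) : ℕ :=
  if h : j < M.numPairs then I.state.symm (I.pair ⟨j, h⟩).1 else 0

/-- The row of an entry, by number. -/
noncomputable def row (e : ℕ) : ℕ :=
  if h : e < M.nnz then I.pair.symm (I.entry ⟨e, h⟩).1.1 else 0

/-- The column of an entry, by number. -/
noncomputable def col (e : ℕ) : ℕ :=
  if h : e < M.nnz then I.state.symm (I.entry ⟨e, h⟩).1.2 else 0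

/-- The reward of a pair, by number. -/
noncomputable def reward (j : ℕ) : ℝ := if h : j < M.numPairs then M.r (I.pair ⟨j, h⟩) else 0

/-- The value of an entry, by number. -/
noncomputable def prob (e : ℕ) : ℝ :=
  if h : e < M.nnz then M.P (I.entry ⟨e, h⟩).1.1 (I.entry ⟨e, h⟩).1.2 else 0

/-- Entries of row `j` correspond to the states of nonzero probability, and the omitted states
contribute nothing to the sum. -/
theorem sum_row_eq (w : S → ℝ) (f : ℕ → ℝ)
    (hf : ∀ e (h : e < M.nnz), f e = w (I.entry ⟨e, h⟩).1.2) {j : ℕ} (hj : j < M.numPairs) :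
    ∑ e ∈ Finset.range M.nnz with I.row e = j, I.prob e * f e =
      ∑ s', M.P (I.pair ⟨j, hj⟩) s' * w s' := by
  classical
  rw [Finset.sum_filter, Finset.sum_range]
  have h1 : ∀ e : Fin M.nnz, (if I.row e = j then I.prob e * f e else 0) =
      (fun z : M.Nonzeros => if z.1.1 = I.pair ⟨j, hj⟩ then M.P z.1.1 z.1.2 * w z.1.2 else 0)
        (I.entry e) := by
    intro e
    have : (I.row e = j) ↔ ((I.entry e).1.1 = I.pair ⟨j, hj⟩) := by
      rw [← Equiv.symm_apply_eq]
      simp only [row, e.2, dite_true, Fin.eta]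
      exact ⟨fun h => Fin.ext h, fun h => by rw [h]⟩
    simp only [this, prob, e.2, dite_true, hf e e.2, Fin.eta]
  rw [Finset.sum_congr rfl fun e _ => h1 e]
  let _ : Fintype M.Nonzeros := Fintype.ofEquiv _ I.entry
  rw [Equiv.sum_comp I.entry fun z : M.Nonzeros =>
    if z.1.1 = I.pair ⟨j, hj⟩ then M.P z.1.1 z.1.2 * w z.1.2 else 0]
  set q := I.pair ⟨j, hj⟩
  rw [← Finset.sum_filter]
  have h2 : ∑ s', M.P q s' * w s' = ∑ s' with M.P q s' ≠ 0, M.P q s' * w s' := by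
    rw [Finset.sum_filter]
    refine Finset.sum_congr rfl fun s' _ => ?_
    split_ifs with h
    · rfl
    · rw [not_not.1 h, zero_mul]
  rw [h2]
  refine Finset.sum_bij' (fun z _ => z.1.2)
    (fun s' hs' => ⟨(q, s'), (Finset.mem_filter.1 hs').2⟩) ?_ ?_ ?_ ?_ ?_
  · intro z hz
    simp only [Finset.mem_filter, Finset.mem_univ, true_and] at hz ⊢
    rw [← hz]; exact z.2
  · intro s' hs'; simp
  · intro z hz
    simp only [Finset.mem_filter, Finset.mem_univ, true_and] at hz
    exact Subtype.ext (Prod.ext hz.symm rfl)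
  · intro s' hs'; rfl
  · intro z hz
    simp only [Finset.mem_filter, Finset.mem_univ, true_and] at hz
    rw [hz]

/-- The process in terms of the numbers of its states, pairs and entries. -/
noncomputable def toTabular : TabularMDP where
  numStates := M.numStates
  numPairs := M.numPairs
  numEntries := M.nnz
  st := I.st
  row := I.row
  col := I.col
  r := I.reward
  P := I.prob
  γ := M.γ
  st_lt j hj := by simp [st, hj]
  row_lt e he := by simp [row, he]
  col_lt e he := by simp [col, he]
  row_mono e e' hee he' := by
    have he := hee.trans_lt he'
    simp only [row, he, he', dite_true]
    exact I.entry_sorted (a := ⟨e, he⟩) (b := ⟨e', he'⟩) hee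
  P_nonneg e he := by simp only [prob, he, dite_true]; exact M.P_nonneg _ _
  row_sum j hj := by
    have := I.sum_row_eq (fun _ => 1) (fun _ => 1) (fun _ _ => rfl) hj
    simpa [M.P_sum] using this
  γ_nonneg := M.γ_nonneg
  γ_lt_one := M.γ_lt_one

/-- A function of the states, as a function of their numbers. -/
noncomputable def tabulate (w : S → ℝ) (i : ℕ) : ℝ :=
  if h : i < M.numStates then w (I.state ⟨i, h⟩) else 0

theorem next_toTabular (v : ℕ → ℝ) {j : ℕ} (hj : j < M.numPairs) :
    I.toTabular.next v j = ∑ s', M.P (I.pair ⟨j, hj⟩) s' * v (I.state.symm s') :=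
  I.sum_row_eq (fun s => v (I.state.symm s)) (fun e => v (I.col e))
    (fun e he => by simp [col, he]) hj

theorem tabulate_symm (w : S → ℝ) (s : S) : I.tabulate w (I.state.symm s) = w s := by
  simp [tabulate]

theorem qValue_eq (v : ℕ → ℝ) {j : ℕ} (hj : j < M.numPairs) :
    I.toTabular.r j + I.toTabular.γ * I.toTabular.next v j =
      M.qValue (fun s => v (I.state.symm s)) (I.pair ⟨j, hj⟩) := by
  rw [next_toTabular I v hj]
  simp [toTabular, reward, hj, qValue]

theorem isOptimal_tabulate [∀ s, Nonempty (A s)] :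
    I.toTabular.IsOptimal (I.tabulate M.optValue) := by
  obtain ⟨π, hπ, hle⟩ := M.optValue_bellman
  intro s hs
  have hw : (fun s => I.tabulate M.optValue (I.state.symm s)) = M.optValue :=
    funext fun s => I.tabulate_symm _ s
  have hs' : I.tabulate M.optValue s = M.optValue (I.state ⟨s, hs⟩) := by
    change dite _ _ _ = _
    exact dif_pos hs
  refine ⟨fun j hj hjs => ?_, ?_⟩
  · rw [I.qValue_eq _ hj, hw]
    refine (hle _ _).trans (le_of_eq ?_)
    have : j < M.numPairs := hj
    simp only [toTabular, st, this, dite_true] at hjs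
    simp only [← hjs]
    rw [tabulate_symm]
    rfl
  · let j := I.pair.symm ⟨I.state ⟨s, hs⟩, π (I.state ⟨s, hs⟩)⟩
    refine ⟨j, j.2, by simp [toTabular, st, j], ?_⟩
    rw [I.qValue_eq _ j.2, hw, hs', hπ]
    simp [j]

end DMDP.Numbering

/-! ### Resampling one draw and the Azuma–Hoeffding inequality -/

namespace RealRAM

instance : IsProbabilityMeasure tapeMeasure := by unfold tapeMeasure; infer_instance

theorem measurable_update_tape (t : ℕ) :
    Measurable fun p : Tape × unitInterval => Function.update p.1 t p.2 := by
  refine measurable_pi_lambda _ fun i => ?_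
  by_cases h : i = t
  · subst h; simpa using measurable_snd
  · simp only [Function.update_of_ne h]
    exact (measurable_pi_apply i).comp measurable_fst

/-- Resampling one random number does not change the law of the tape. -/
theorem map_update_tapeMeasure (t : ℕ) :
    (tapeMeasure.prod volume).map (fun p : Tape × unitInterval => Function.update p.1 t p.2) =
      tapeMeasure := by
  refine Measure.eq_infinitePi _ fun s A hA => ?_
  rw [Measure.map_apply (measurable_update_tape t) (.pi s.countable_toSet fun i _ => hA i)]
  have h1 : (fun p : Tape × unitInterval => Function.update p.1 t p.2) ⁻¹' (Set.pi s A) =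
      (Set.pi (s.erase t : Finset ℕ) A) ×ˢ (if t ∈ s then A t else Set.univ) := by
    ext ⟨ω, u⟩
    simp only [Set.mem_preimage, Set.mem_pi, Finset.mem_coe, Set.mem_prod, Finset.mem_erase]
    constructor
    · refine fun H => ⟨fun i hi => by simpa [hi.1] using H i hi.2, ?_⟩
      split_ifs with ht
      · simpa using H t ht
      · trivial
    · rintro ⟨H1, H2⟩ i hi
      by_cases hit : i = t
      · subst hit; simpa [hi] using H2
      · simpa [hit] using H1 i ⟨hit, hi⟩
  rw [h1, Measure.prod_prod, tapeMeasure, Measure.infinitePi_pi _ fun i _ => hA i]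
  split_ifs with ht
  · exact Finset.prod_erase_mul s _ ht
  · rw [Finset.erase_eq_of_notMem ht]; simp

/-- Fubini for a single coordinate. It plays the role of conditional expectation, so that no
filtration is needed. -/
theorem lintegral_tape_update (t : ℕ) {f : Tape → ENNReal} (hf : Measurable f) :
    ∫⁻ ω, f ω ∂tapeMeasure = ∫⁻ ω, ∫⁻ u, f (Function.update ω t u) ∂volume ∂tapeMeasure := by
  conv_lhs => rw [← map_update_tapeMeasure t]
  rw [lintegral_map hf (measurable_update_tape t),
    lintegral_prod (fun p => f (Function.update p.1 t p.2)) (hf.comp (measurable_update_tape t)).aemeasurable]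

/-- Hoeffding's lemma on `[-h, h]`, where the variance proxy is `((h - -h) / 2) ^ 2 = h ^ 2`. -/
theorem lintegral_exp_le_of_bounded {X : unitInterval → ℝ} (hX : Measurable X) {h : ℝ}
    (hb : ∀ u, |X u| ≤ h) (l : ℝ) :
    ∫⁻ u, ENNReal.ofReal (Real.exp (l * (X u - ∫ u, X u))) ≤
      ENNReal.ofReal (Real.exp (h ^ 2 * l ^ 2 / 2)) := by
  have hs := ProbabilityTheory.hasSubgaussianMGF_of_mem_Icc (μ := volume) (a := -h) (b := h)
    hX.aemeasurable (.of_forall fun u => abs_le.1 (hb u))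
  rw [← ofReal_integral_eq_lintegral_ofReal (hs.integrable_exp_mul l)
    (.of_forall fun _ => (Real.exp_pos _).le)]
  refine ENNReal.ofReal_le_ofReal ((hs.mgf_le l).trans (le_of_eq ?_))
  have : ((‖h - -h‖₊ / 2 : NNReal) : ℝ) ^ 2 = h ^ 2 := by
    simp only [NNReal.coe_div, coe_nnnorm, Real.norm_eq_abs, div_pow, sq_abs]
    norm_num; ring
  push_cast at this ⊢
  rw [this]

/-- An adapted sum of centred bounded terms, of which the term number `i` uses the random number
`t₀ + i`. -/
structure IsBoundedMartingale (t₀ : ℕ) (h : ℝ) (W : ℕ → Tape → ℝ)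
    (X : ℕ → Tape → unitInterval → ℝ) : Prop where
  zero : ∀ ω, W 0 ω = 0
  succ : ∀ i ω, W (i + 1) ω = W i ω + (X i ω (ω (t₀ + i)) - ∫ u, X i ω u)
  measurable_left : ∀ i, Measurable (W i)
  measurable_right : ∀ i, Measurable (Function.uncurry (X i))
  -- Predictability, in the form that `lintegral_tape_update` uses: `W i` and `X i` ignore the draw
  -- number `t₀ + i`.
  update_left : ∀ i ω u, W i (Function.update ω (t₀ + i) u) = W i ω
  update_right : ∀ i ω u, X i (Function.update ω (t₀ + i) u) = X i ω
  bound : ∀ i ω u, |X i ω u| ≤ h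

variable {t₀ : ℕ} {h : ℝ} {W : ℕ → Tape → ℝ} {X : ℕ → Tape → unitInterval → ℝ}

theorem IsBoundedMartingale.neg (H : IsBoundedMartingale t₀ h W X) :
    IsBoundedMartingale t₀ h (fun i ω => - W i ω) fun i ω u => - X i ω u where
  zero ω := by simp [H.zero]
  succ i ω := by rw [H.succ, integral_neg]; ring
  measurable_left i := (H.measurable_left i).neg
  measurable_right i := (H.measurable_right i).neg
  update_left i ω u := by rw [H.update_left]
  update_right i ω u := by rw [H.update_right]
  bound i ω u := by rw [abs_neg]; exact H.bound i ω u

/-- Integrating the draw `t₀ + n` first leaves `W n` fixed and costs one Hoeffding factor. -/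
theorem IsBoundedMartingale.lintegral_exp_le (H : IsBoundedMartingale t₀ h W X) (l : ℝ) (n : ℕ) :
    ∫⁻ ω, ENNReal.ofReal (Real.exp (l * W n ω)) ∂tapeMeasure ≤
      ENNReal.ofReal (Real.exp (n * (h ^ 2 * l ^ 2 / 2))) := by
  induction n with
  | zero => simp [H.zero]
  | succ n ih =>
    have hm : Measurable fun ω => ENNReal.ofReal (Real.exp (l * W (n + 1) ω)) :=
      ENNReal.measurable_ofReal.comp
        (Real.measurable_exp.comp ((H.measurable_left (n + 1)).const_mul l))
    rw [lintegral_tape_update (t₀ + n) hm]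
    have h1 : ∀ ω u, ENNReal.ofReal (Real.exp (l * W (n + 1) (Function.update ω (t₀ + n) u))) =
        ENNReal.ofReal (Real.exp (l * W n ω)) *
          ENNReal.ofReal (Real.exp (l * (X n ω u - ∫ u, X n ω u))) := by
      intro ω u
      rw [H.succ, H.update_left, H.update_right, Function.update_self,
        ← ENNReal.ofReal_mul (Real.exp_pos _).le, ← Real.exp_add, mul_add]
    simp_rw [h1]
    calc _ ≤ ∫⁻ ω, ENNReal.ofReal (Real.exp (l * W n ω)) *
            ENNReal.ofReal (Real.exp (h ^ 2 * l ^ 2 / 2)) ∂tapeMeasure := by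
          refine lintegral_mono fun ω => ?_
          rw [lintegral_const_mul' _ _ ENNReal.ofReal_ne_top]
          exact mul_le_mul_right (lintegral_exp_le_of_bounded
            ((H.measurable_right n).comp measurable_prodMk_left) (H.bound n ω) l) _
      _ ≤ _ := by
          rw [lintegral_mul_const' _ _ ENNReal.ofReal_ne_top]
          refine (mul_le_mul_left ih _).trans (le_of_eq ?_)
          rw [← ENNReal.ofReal_mul (Real.exp_pos _).le, ← Real.exp_add]
          congr 2
          push_cast
          ring

theorem IsBoundedMartingale.measure_ge_le (H : IsBoundedMartingale t₀ h W X) {n L m c : ℕ}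
    (hh : 0 < h) (hnL : n ≤ L) (hL : 0 < L) (hm : 2 * c * L ≤ m ^ 2) :
    tapeMeasure {ω | m * h ≤ W n ω} ≤ ENNReal.ofReal (Real.exp (-c)) := by
  -- The Chernoff parameter that is optimal for `n = L`; the exponent becomes `-m ^ 2 / (2 * L) ≤
  -- -c`.
  set l : ℝ := m / (L * h) with hl
  have hLr : (0 : ℝ) < L := by exact_mod_cast hL
  have hmr : 2 * (c : ℝ) * L ≤ m ^ 2 := by exact_mod_cast hm
  have hl0 : 0 ≤ l := by positivity
  have hmeas : Measurable fun ω => ENNReal.ofReal (Real.exp (l * W n ω)) :=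
    ENNReal.measurable_ofReal.comp
      (Real.measurable_exp.comp ((H.measurable_left n).const_mul l))
  have h1 : tapeMeasure {ω | m * h ≤ W n ω} ≤
      tapeMeasure {ω | ENNReal.ofReal (Real.exp (l * (m * h))) ≤
        ENNReal.ofReal (Real.exp (l * W n ω))} :=
    measure_mono fun ω hω => ENNReal.ofReal_le_ofReal
      (Real.exp_le_exp.2 (mul_le_mul_of_nonneg_left hω hl0))
  refine h1.trans ((meas_ge_le_lintegral_div hmeas.aemeasurable
    (by simp [Real.exp_pos]) ENNReal.ofReal_ne_top).trans ?_)
  refine (ENNReal.div_le_div_right (H.lintegral_exp_le l n) _).trans ?_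
  rw [← ENNReal.ofReal_div_of_pos (Real.exp_pos _), ← Real.exp_sub]
  refine ENNReal.ofReal_le_ofReal (Real.exp_le_exp.2 ?_)
  have h2 : (n : ℝ) * (h ^ 2 * l ^ 2 / 2) ≤ L * (h ^ 2 * l ^ 2 / 2) :=
    mul_le_mul_of_nonneg_right (by exact_mod_cast hnL) (by positivity)
  have h3 : (L : ℝ) * (h ^ 2 * l ^ 2 / 2) = m ^ 2 / (2 * L) := by
    rw [hl]; field_simp
  have h4 : l * (m * h) = m ^ 2 / L := by rw [hl]; field_simp
  have h5 : (c : ℝ) ≤ m ^ 2 / (2 * L) := by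
    rw [le_div_iff₀ (by positivity)]; linarith
  have h6 : (m : ℝ) ^ 2 / L = m ^ 2 / (2 * L) + m ^ 2 / (2 * L) := by field_simp; ring
  linarith

/-- The Azuma–Hoeffding inequality. -/
theorem IsBoundedMartingale.measure_abs_ge_le (H : IsBoundedMartingale t₀ h W X) {n L m c : ℕ}
    (hh : 0 < h) (hnL : n ≤ L) (hL : 0 < L) (hm : 2 * c * L ≤ m ^ 2) :
    tapeMeasure {ω | m * h ≤ |W n ω|} ≤ ENNReal.ofReal (2 * Real.exp (-c)) := by
  have : {ω | m * h ≤ |W n ω|} ⊆ {ω | m * h ≤ W n ω} ∪ {ω | m * h ≤ - W n ω} := fun ω hω => by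
    simpa [le_abs] using hω
  refine (measure_mono this).trans ((measure_union_le _ _).trans ?_)
  rw [two_mul, ENNReal.ofReal_add (Real.exp_pos _).le (Real.exp_pos _).le]
  exact add_le_add (H.measure_ge_le hh hnL hL hm) (H.neg.measure_ge_le hh hnL hL hm)

end RealRAM

namespace TabularMDP

open RealRAM Finset

variable (D : TabularMDP)

/-! ### Sampling -/

/-- The sum of the entries of the transition matrix up to the entry number `e`. -/
noncomputable def cum (e : ℕ) : ℝ := ∑ e' ∈ range (e + 1), D.P e'

/-- The entry of the row `j` that is selected by the random number `u`. As every row sums to `1`,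
the sums `cum` of the entries of row `j` lie between `j` and `j + 1`. -/
noncomputable def sample (j : ℕ) (u : ℝ) : ℕ :=
  open Classical in #{e ∈ range D.numEntries | D.cum e < j + u}

theorem cum_mono {e e' : ℕ} (h : e ≤ e') (he' : e' < D.numEntries) : D.cum e ≤ D.cum e' := by
  refine sum_le_sum_of_subset_of_nonneg (range_mono (by omega)) fun i hi _ => ?_
  exact D.P_nonneg i (by have := mem_range.1 hi; omega)

/-- The first `j` rows have total mass `j`. Hence one array of partial sums serves all rows: row `j`
occupies `[j, j + 1]`. -/
theorem sum_row_lt {j : ℕ} (hj : j ≤ D.numPairs) :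
    ∑ e ∈ range D.numEntries with D.row e < j, D.P e = j := by
  induction j with
  | zero => simp
  | succ j ih =>
    have h1 : (range D.numEntries).filter (fun e => D.row e < j + 1) =
        (range D.numEntries).filter (fun e => D.row e < j) ∪
          (range D.numEntries).filter (fun e => D.row e = j) := by
      ext e; simp only [mem_filter, mem_union, mem_range]; omega
    rw [h1, sum_union, ih (by omega), D.row_sum j hj]
    · push_cast; rfl
    · rw [disjoint_left]; intro e; simp only [mem_filter]; omega

theorem le_cum_pred {e : ℕ} (he : e < D.numEntries) : D.row e ≤ ∑ e' ∈ range e, D.P e' := by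
  rw [← D.sum_row_lt (D.row_lt e he).le]
  refine sum_le_sum_of_subset_of_nonneg (fun i hi => ?_) fun i hi _ => ?_
  · simp only [mem_filter, mem_range] at hi ⊢
    by_contra h
    have := D.row_mono e i (by omega) hi.1
    omega
  · exact D.P_nonneg i (by have := mem_range.1 hi; omega)

theorem cum_le {e : ℕ} (he : e < D.numEntries) : D.cum e ≤ D.row e + 1 := by
  have := D.sum_row_lt (j := D.row e + 1) (D.row_lt e he)
  push_cast at this
  rw [← this]
  refine sum_le_sum_of_subset_of_nonneg (fun i hi => ?_) fun i hi _ => ?_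
  · simp only [mem_filter, mem_range] at hi ⊢
    exact ⟨by omega, Nat.lt_succ_of_le (D.row_mono i e (by omega) he)⟩
  · exact D.P_nonneg i (mem_range.1 (mem_filter.1 hi).1)

theorem cum_last (h : 0 < D.numEntries) : D.cum (D.numEntries - 1) = D.numPairs := by
  rw [← D.sum_row_lt le_rfl, cum, Nat.sub_add_cancel h, filter_true_of_mem]
  exact fun e he => D.row_lt e (mem_range.1 he)

theorem sample_eq {j e : ℕ} {u : ℝ} (he : e < D.numEntries) (h1 : ∀ e' < e, D.cum e' < j + u)
    (h2 : j + u ≤ D.cum e) : D.sample j u = e := by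
  classical
  have : (range D.numEntries).filter (fun e => D.cum e < j + u) = range e := by
    ext i
    simp only [mem_filter, mem_range]
    refine ⟨fun hi => ?_, fun hi => ⟨by omega, h1 i hi⟩⟩
    by_contra hie
    exact absurd hi.2 (not_lt.2 (h2.trans (D.cum_mono (by omega) hi.1)))
  rw [sample]
  convert card_range e

theorem sample_lt {j : ℕ} (hj : j < D.numPairs) {u : ℝ} (hu : u ≤ 1) :
    D.sample j u < D.numEntries := by
  classical
  have h0 : 0 < D.numEntries := by
    by_contra h
    have := D.row_sum j hj
    simp [Nat.eq_zero_of_not_pos h] at this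
  -- The last partial sum is `numPairs ≥ j + 1 ≥ j + u`, so the last entry is never counted and the
  -- index stays in range.
  have hmem : D.numEntries - 1 ∉ (range D.numEntries).filter (fun e => D.cum e < j + u) := by
    simp only [mem_filter, not_and, not_lt, D.cum_last h0]
    intro _
    have : (j : ℝ) + 1 ≤ D.numPairs := by exact_mod_cast hj
    linarith
  have := card_lt_card (s := (range D.numEntries).filter (fun e => D.cum e < j + u))
    (t := range D.numEntries) ((filter_subset _ _).ssubset_of_not_subset
      fun h => hmem (h (mem_range.2 (by omega))))
  rw [card_range] at this
  rw [sample]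
  convert this

theorem measurable_sample (j : ℕ) : Measurable fun u : unitInterval => D.sample j u := by
  classical
  have h : (fun u : unitInterval => D.sample j u) =
      fun u : unitInterval => ∑ e ∈ range D.numEntries, if D.cum e < j + u then 1 else 0 := by
    funext u
    rw [← card_filter, sample]
  rw [h]
  exact Finset.measurable_sum _ fun e _ => Measurable.ite
    (measurableSet_lt measurable_const (measurable_subtype_coe.const_add _)) measurable_const
    measurable_const

/-- The sets `B e`, for `e` in row `j`, are disjoint half-open intervals of length `P e`, on each of
which the sample is constant. Their lengths add up to `1`, so they miss only a null set, such as `u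
= 0`, where the sample may fall outside the row. -/
theorem integral_sample {j : ℕ} (hj : j < D.numPairs) (f : ℕ → ℝ) :
    ∫ u : unitInterval, f (D.col (D.sample j u)) = D.next f j := by
  classical
  let B : ℕ → Set unitInterval := fun e =>
    {u | ∑ e' ∈ range e, D.P e' < j + (u : ℝ) ∧ j + (u : ℝ) ≤ D.cum e}
  set s := (range D.numEntries).filter (fun e => D.row e = j) with hs
  have hBm : ∀ e, MeasurableSet (B e) := fun e =>
    (measurableSet_lt measurable_const (measurable_subtype_coe.const_add _)).inter
      (measurableSet_le (measurable_subtype_coe.const_add _) measurable_const)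
  have hBs : ∀ e ∈ s, ∀ u ∈ B e, D.sample j u = e := by
    intro e he u hu
    have he' := mem_range.1 (mem_filter.1 he).1
    refine D.sample_eq he' (fun e' hee => lt_of_le_of_lt ?_ hu.1) hu.2
    refine sum_le_sum_of_subset_of_nonneg (range_mono (by omega)) fun i hi _ => ?_
    exact D.P_nonneg i (by have := mem_range.1 hi; omega)
  have hBv : ∀ e ∈ s, volume (B e) = ENNReal.ofReal (D.P e) := by
    intro e he
    obtain ⟨he', hej⟩ := mem_filter.1 he
    rw [mem_range] at he'
    have hcum : D.cum e = ∑ e' ∈ range e, D.P e' + D.P e := sum_range_succ _ _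
    have h1 := D.le_cum_pred he'
    have h2 := D.cum_le he'
    have h3 := D.P_nonneg e he'
    rw [hej] at h1 h2
    have : B e = Set.Ioc
        (⟨∑ e' ∈ range e, D.P e' - j, by constructor <;> linarith⟩ : unitInterval)
        ⟨D.cum e - j, by constructor <;> linarith⟩ := by
      ext u
      simp only [B, Set.mem_ofPred_eq, Set.mem_Ioc, ← Subtype.coe_lt_coe, ← Subtype.coe_le_coe]
      constructor <;> rintro ⟨h, h'⟩ <;> constructor <;> linarith
    rw [this, unitInterval.volume_Ioc]
    congr 1
    simp only [hcum]
    ring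
  have hdisj : Set.Pairwise (s : Set ℕ) (Function.onFun Disjoint B) := by
    intro e he e' he' hne
    refine Set.disjoint_left.2 fun u hu hu' => hne ?_
    rw [← hBs e he u hu, hBs e' he' u hu']
  have hU : volume (⋃ e ∈ s, B e) = 1 := by
    rw [measure_biUnion_finset hdisj fun e _ => hBm e, sum_congr rfl hBv,
      ← ENNReal.ofReal_sum_of_nonneg fun e he => D.P_nonneg e (mem_range.1 (mem_filter.1 he).1),
      D.row_sum j hj, ENNReal.ofReal_one]
  have hae : (⋃ e ∈ s, B e) =ᵐ[volume] Set.univ := by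
    rw [ae_eq_univ, prob_compl_eq_zero_iff (s.measurableSet_biUnion fun e _ => hBm e)]
    exact hU
  rw [← setIntegral_univ, ← setIntegral_congr_set hae,
    integral_biUnion_finset s (fun e _ => hBm e) hdisj, next]
  · refine sum_congr rfl fun e he => ?_
    rw [setIntegral_congr_fun (g := fun _ => f (D.col e)) (hBm e)
      fun u hu => by simp only [hBs e he u hu], setIntegral_const, measureReal_def, hBv e he,
      ENNReal.toReal_ofReal (D.P_nonneg e (mem_range.1 (mem_filter.1 he).1)), smul_eq_mul]
  · intro e he
    refine (integrableOn_const (C := f (D.col e)) (by finiteness)).congr_fun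
      (fun u hu => by simp only [hBs e he u hu]) (hBm e)

/-! ### Truncated value iteration -/

/-- The change of the value of the state `s` in a round of value iteration, truncated to `[-h, h]`.
Here `x` is an estimate of `D.next v`. -/
noncomputable def change (h : ℝ) (v x : ℕ → ℝ) (s : ℕ) : ℝ :=
  (range D.numPairs |>.filter fun j => D.st j = s).fold max (-h) fun j =>
    min h (D.r j + D.γ * x j - v s)

/-- A round of value iteration, in which the estimate of `D.next v` is updated with a single sample
for each pair. -/
noncomputable def round (h : ℝ) (u : unitInterval) (z : (ℕ → ℝ) × (ℕ → ℝ)) :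
    (ℕ → ℝ) × (ℕ → ℝ) :=
  (fun s => z.1 s + D.change h z.1 z.2 s,
    fun j => z.2 j + D.change h z.1 z.2 (D.col (D.sample j u)))

/-- The memory after `i` rounds that start from the values `v` and use the random numbers from
number `t` on. -/
noncomputable def rounds (h : ℝ) (ω : Tape) (t : ℕ) (v : ℕ → ℝ) : ℕ → (ℕ → ℝ) × (ℕ → ℝ)
  | 0 => (v, D.next v)
  | i + 1 => D.round h (ω (t + i)) (rounds h ω t v i)

/-- The values after `k` epochs of `L` rounds each. -/
noncomputable def epochs (h : ℝ) (L : ℕ) (ω : Tape) : ℕ → ℕ → ℝ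
  | 0 => 0
  | k + 1 => (D.rounds (h / 2 ^ k) ω (k * L) (epochs h L ω k) L).1

theorem change_le {h : ℝ} {v x : ℕ → ℝ} {s : ℕ} {b : ℝ} (hb : -h ≤ b)
    (H : ∀ j < D.numPairs, D.st j = s → min h (D.r j + D.γ * x j - v s) ≤ b) :
    D.change h v x s ≤ b := by
  refine (fold_max_le _).2 ⟨hb, fun j hj => ?_⟩
  obtain ⟨hj, hs⟩ := mem_filter.1 hj
  exact H j (mem_range.1 hj) hs

theorem le_change {h : ℝ} {v x : ℕ → ℝ} {s j : ℕ} (hj : j < D.numPairs) (hs : D.st j = s) :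
    min h (D.r j + D.γ * x j - v s) ≤ D.change h v x s :=
  (le_fold_max _).2 (.inr ⟨j, mem_filter.2 ⟨mem_range.2 hj, hs⟩, le_rfl⟩)

theorem abs_change_le {h : ℝ} (hh : 0 ≤ h) (v x : ℕ → ℝ) (s : ℕ) : |D.change h v x s| ≤ h :=
  abs_le.2 ⟨(le_fold_max _).2 (.inl le_rfl),
    D.change_le (by linarith) fun _ _ _ => min_le_left _ _⟩

theorem next_add (v w : ℕ → ℝ) (j : ℕ) :
    D.next (fun s => v s + w s) j = D.next v j + D.next w j := by
  simp [next, mul_add, sum_add_distrib]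

theorem abs_next_sub_le {v w : ℕ → ℝ} {c : ℝ} (h : ∀ s < D.numStates, |v s - w s| ≤ c) {j : ℕ}
    (hj : j < D.numPairs) : |D.next v j - D.next w j| ≤ c := by
  rw [next, next, ← sum_sub_distrib]
  calc _ ≤ ∑ e ∈ range D.numEntries with D.row e = j, D.P e * c := by
        refine (abs_sum_le_sum_abs _ _).trans (sum_le_sum fun e he => ?_)
        have he' := mem_range.1 (mem_filter.1 he).1
        rw [← mul_sub, abs_mul, abs_of_nonneg (D.P_nonneg e he')]
        exact mul_le_mul_of_nonneg_left (h _ (D.col_lt e he')) (D.P_nonneg e he')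
    _ = c := by rw [← sum_mul, D.row_sum j hj, one_mul]

/-- An untruncated update has error at most `γ * (a + b)`. The cap `h` matters only for the lower
bound, tested at an optimal pair, and the floor `-h` only for the upper bound; where either applies,
the old bound `a` improves by `h`. -/
theorem abs_round_sub_le {u v x : ℕ → ℝ} (hu : D.IsOptimal u) {h a b : ℝ}
    (hv : ∀ s < D.numStates, |v s - u s| ≤ a) (hx : ∀ j < D.numPairs, |x j - D.next v j| ≤ b)
    {s : ℕ} (hs : s < D.numStates) :
    |v s + D.change h v x s - u s| ≤ max (D.γ * (a + b)) (a - h) := by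
  have hq : ∀ j < D.numPairs, |D.γ * x j - D.γ * D.next u j| ≤ D.γ * (a + b) := by
    intro j hj
    rw [← mul_sub, abs_mul, abs_of_nonneg D.γ_nonneg]
    refine mul_le_mul_of_nonneg_left ?_ D.γ_nonneg
    have h1 := hx j hj
    have h2 := D.abs_next_sub_le hv hj
    have := abs_sub_le (x j) (D.next v j) (D.next u j)
    linarith
  have hvs := abs_le.1 (hv s hs)
  obtain ⟨hle, j, hj, hjs, hju⟩ := hu s hs
  rw [abs_le]
  constructor
  · have h1 := D.le_change (h := h) (v := v) (x := x) hj hjs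
    have h2 := abs_le.1 (hq j hj)
    rcases min_choice h (D.r j + D.γ * x j - v s) with h3 | h3 <;> rw [h3] at h1
    · linarith [le_max_right (D.γ * (a + b)) (a - h)]
    · linarith [le_max_left (D.γ * (a + b)) (a - h)]
  · have : D.change h v x s ≤ u s - v s + max (D.γ * (a + b)) (a - h) := by
      refine D.change_le ?_ fun i hi his => ?_
      · linarith [le_max_right (D.γ * (a + b)) (a - h)]
      · have h1 := hle i hi his
        have h2 := abs_le.1 (hq i hi)
        have h3 := min_le_right h (D.r i + D.γ * x i - v s)
        linarith [le_max_left (D.γ * (a + b)) (a - h)]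
    linarith

/-- The error of the estimates in round `i` of an epoch. -/
noncomputable def error (h : ℝ) (ω : Tape) (t : ℕ) (v : ℕ → ℝ) (i j : ℕ) : ℝ :=
  (D.rounds h ω t v i).2 j - D.next (D.rounds h ω t v i).1 j

/-- If all estimates are accurate, then the rounds halve the distance to the optimal values. -/
theorem abs_rounds_sub_le {u v : ℕ → ℝ} (hu : D.IsOptimal u) {N m : ℕ} (hN : 0 < N) (hm : 0 < m)
    (hγ : 1 ≤ N * (1 - D.γ)) {h : ℝ} (hh : 0 ≤ h) (ω : Tape) (t : ℕ)
    (hv : ∀ s < D.numStates, |v s - u s| ≤ 4 * N * m * h)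
    (herr : ∀ i < 2 * N * m, ∀ j < D.numPairs, |D.error h ω t v i j| ≤ m * h)
    {s : ℕ} (hs : s < D.numStates) :
    |(D.rounds h ω t v (2 * N * m)).1 s - u s| ≤ 2 * N * m * h := by
  have hNr : (1 : ℝ) ≤ N := by exact_mod_cast hN
  have hmr : (1 : ℝ) ≤ m := by exact_mod_cast hm
  -- The bound decreases by `h` in every round.
  suffices H : ∀ i ≤ 2 * N * m, ∀ s < D.numStates,
      |(D.rounds h ω t v i).1 s - u s| ≤ 4 * N * m * h - i * h by
    refine (H _ le_rfl s hs).trans (le_of_eq ?_)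
    push_cast; ring
  intro i
  induction i with
  | zero => intro _ s hs; simpa [rounds] using hv s hs
  | succ i ih =>
    intro hi s hs
    refine (D.abs_round_sub_le hu (h := h) (ih (by omega)) (herr i (by omega)) hs).trans
      (max_le ?_ (by push_cast; linarith))
    have hi' : (i : ℝ) + 1 ≤ 2 * N * m := by exact_mod_cast hi
    have h1 : (i + 1 : ℝ) * h ≤ 2 * N * m * h := mul_le_mul_of_nonneg_right hi' hh
    have hγ' : D.γ ≤ 1 - 1 / N := by
      have : 1 / (N : ℝ) ≤ 1 - D.γ := by rw [div_le_iff₀ (by linarith)]; linarith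
      linarith
    have hmh : h ≤ m * h := by nlinarith
    have hmh0 : 0 ≤ m * h := by positivity
    calc D.γ * (4 * N * m * h - i * h + m * h)
        ≤ (1 - 1 / N) * (4 * N * m * h - i * h + m * h) :=
          mul_le_mul_of_nonneg_right hγ' (by nlinarith)
      _ = 4 * N * m * h - i * h + m * h - (4 * N * m * h - i * h + m * h) / N := by
          field_simp
      -- Before the last round is over, the error bound is at least `2 * N * m * h`, so the factor
      -- `1 - 1 / N` gains `2 * m * h`: one half cancels the noise, the other covers the required
      -- decrease `h ≤ m * h`.
      _ ≤ 4 * N * m * h - i * h + m * h - 2 * (m * h) := by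
          have : 2 * (m * h) ≤ (4 * N * m * h - i * h + m * h) / N := by
            rw [le_div_iff₀ (by linarith)]; nlinarith
          linarith
      _ ≤ 4 * N * m * h - (i + 1 : ℕ) * h := by push_cast; linarith

/-- The width `1 / (4 * m) / 2 ^ k` is chosen so that `4 * N * m` times it is `N / 2 ^ k`, the error
bound on entering epoch `k`. -/
theorem abs_epochs_sub_le {u : ℕ → ℝ} (hu : D.IsOptimal u) {N m : ℕ} (hN : 0 < N) (hm : 0 < m)
    (hγ : 1 ≤ N * (1 - D.γ)) (hu0 : ∀ s < D.numStates, |u s| ≤ N) (ω : Tape) (K : ℕ)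
    (herr : ∀ k < K, ∀ i < 2 * N * m, ∀ j < D.numPairs,
      |D.error (1 / (4 * m) / 2 ^ k) ω (k * (2 * N * m))
        (D.epochs (1 / (4 * m)) (2 * N * m) ω k) i j| ≤ m * (1 / (4 * m) / 2 ^ k))
    {s : ℕ} (hs : s < D.numStates) :
    |D.epochs (1 / (4 * m)) (2 * N * m) ω K s - u s| ≤ N / 2 ^ K := by
  have hmr : (0 : ℝ) < m := by exact_mod_cast hm
  induction K generalizing s with
  | zero => simpa [epochs] using hu0 s hs
  | succ K ih =>
    have h1 := D.abs_rounds_sub_le hu hN hm hγ (h := 1 / (4 * m) / 2 ^ K) (by positivity) ω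
      (K * (2 * N * m)) (v := D.epochs (1 / (4 * m)) (2 * N * m) ω K)
      (fun s hs => (ih (fun k hk => herr k (by omega)) hs).trans (le_of_eq (by field_simp)))
      (herr K (by omega)) hs
    refine h1.trans (le_of_eq ?_)
    rw [pow_succ]
    field_simp
    norm_num

/-! ### Concentration of the estimates -/

theorem measurable_change (h : ℝ) (s : ℕ) :
    Measurable fun z : (ℕ → ℝ) × (ℕ → ℝ) => D.change h z.1 z.2 s := by
  unfold change
  generalize (range D.numPairs |>.filter fun j => D.st j = s) = F
  induction F using Finset.induction_on with
  | empty => simp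
  | insert a F ha ih =>
    simp only [fold_insert ha]
    refine Measurable.max (measurable_const.min ?_) ih
    exact ((((measurable_pi_apply a).comp measurable_snd).const_mul _).const_add _).sub
      ((measurable_pi_apply s).comp measurable_fst)

theorem measurable_change_sample (h : ℝ) (j : ℕ) :
    Measurable fun p : ((ℕ → ℝ) × (ℕ → ℝ)) × unitInterval =>
      D.change h p.1.1 p.1.2 (D.col (D.sample j p.2)) := by
  have h1 : Measurable fun p : ((ℕ → ℝ) × (ℕ → ℝ)) × ℕ => D.change h p.1.1 p.1.2 (D.col p.2) :=
    measurable_from_prod_countable_left fun e => D.measurable_change h (D.col e)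
  exact h1.comp (measurable_fst.prodMk ((D.measurable_sample j).comp measurable_snd))

theorem measurable_round (h : ℝ) :
    Measurable fun p : ((ℕ → ℝ) × (ℕ → ℝ)) × unitInterval => D.round h p.2 p.1 := by
  refine Measurable.prodMk (measurable_pi_lambda _ fun s => ?_) (measurable_pi_lambda _ fun j => ?_)
  · exact (((measurable_pi_apply s).comp measurable_fst).add (D.measurable_change h s)).comp
      measurable_fst
  · exact ((((measurable_pi_apply j).comp measurable_snd).comp measurable_fst)).add
      (D.measurable_change_sample h j)

theorem measurable_next (j : ℕ) : Measurable fun v : ℕ → ℝ => D.next v j :=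
  Finset.measurable_sum _ fun e _ => (measurable_pi_apply (D.col e)).const_mul _

theorem measurable_rounds (h : ℝ) (t : ℕ) {v : Tape → ℕ → ℝ} (hv : Measurable v) (i : ℕ) :
    Measurable fun ω => D.rounds h ω t (v ω) i := by
  induction i with
  | zero =>
    exact hv.prodMk (measurable_pi_lambda _ fun j => (D.measurable_next j).comp hv)
  | succ i ih => exact (D.measurable_round h).comp (ih.prodMk (measurable_pi_apply (t + i)))

theorem measurable_epochs (h : ℝ) (L k : ℕ) : Measurable fun ω => D.epochs h L ω k := by
  induction k with
  | zero => exact measurable_const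
  | succ k ih => exact measurable_fst.comp (D.measurable_rounds _ _ ih L)

/-- Adaptedness: the first `i` rounds read no draw from number `t + i` on. -/
theorem rounds_congr (h : ℝ) {ω ω' : Tape} {t : ℕ} (v : ℕ → ℝ) {i : ℕ}
    (H : ∀ l < t + i, ω l = ω' l) : D.rounds h ω t v i = D.rounds h ω' t v i := by
  induction i with
  | zero => rfl
  | succ i ih =>
    rw [rounds, rounds, ih fun l hl => H l (by omega), H (t + i) (by omega)]

theorem epochs_congr (h : ℝ) {ω ω' : Tape} {L k : ℕ} (H : ∀ l < k * L, ω l = ω' l) :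
    D.epochs h L ω k = D.epochs h L ω' k := by
  induction k with
  | zero => rfl
  | succ k ih =>
    rw [epochs, epochs, ih fun l hl => H l (hl.trans_le (Nat.mul_le_mul_right L (by omega))),
      D.rounds_congr _ _ fun l hl => H l (by rw [Nat.succ_mul]; exact hl)]

/-- The estimate starts exact. In a round it gains the sampled change, while `next` of the values
gains the mean of that change, by linearity and `integral_sample`. The starting values may be
random, provided that they depend only on draws before `t`. -/
theorem isBoundedMartingale_error {h : ℝ} (hh : 0 ≤ h) (t : ℕ) {v : Tape → ℕ → ℝ}
    (hv : Measurable v) (hv' : ∀ ω ω' : Tape, (∀ l < t, ω l = ω' l) → v ω = v ω') {j : ℕ}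
    (hj : j < D.numPairs) :
    IsBoundedMartingale t h (fun i ω => D.error h ω t (v ω) i j) fun i ω u =>
      D.change h (D.rounds h ω t (v ω) i).1 (D.rounds h ω t (v ω) i).2
        (D.col (D.sample j u)) := by
  have hupd : ∀ i (ω : Tape) u,
      D.rounds h (Function.update ω (t + i) u) t (v (Function.update ω (t + i) u)) i =
        D.rounds h ω t (v ω) i := by
    intro i ω u
    have H : ∀ l < t + i, Function.update ω (t + i) u l = ω l := fun l hl =>
      Function.update_of_ne (by omega) _ _
    rw [D.rounds_congr h _ H, hv' _ ω fun l hl => H l (by omega)]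
  have hm := fun i => D.measurable_rounds h t hv i
  refine ⟨fun ω => by simp [error, rounds], fun i ω => ?_, fun i => ?_, fun i => ?_,
    fun i ω u => ?_, fun i ω u => ?_, fun i ω u => D.abs_change_le hh _ _ _⟩
  · rw [D.integral_sample hj]
    simp only [error, rounds, round, next_add]
    ring
  · exact ((measurable_pi_apply j).comp (measurable_snd.comp (hm i))).sub
      ((D.measurable_next j).comp (measurable_fst.comp (hm i)))
  · have h1 := (D.measurable_change_sample h j).comp
      (((hm i).comp (measurable_fst (β := unitInterval))).prodMk measurable_snd)
    exact h1
  · simp only [error, hupd]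
  · rw [hupd]

/-- With high probability, all estimates are accurate. -/
theorem measure_error_le {N m c K : ℕ} (hN : 0 < N) (hm : 0 < m) (hc : 4 * c * N ≤ m) :
    tapeMeasure {ω | ¬ ∀ k < K, ∀ i < 2 * N * m, ∀ j < D.numPairs,
      |D.error (1 / (4 * m) / 2 ^ k) ω (k * (2 * N * m))
        (D.epochs (1 / (4 * m)) (2 * N * m) ω k) i j| ≤ m * (1 / (4 * m) / 2 ^ k)} ≤
      ENNReal.ofReal (K * (2 * N * m) * D.numPairs * (2 * Real.exp (-c))) := by
  -- Union bound over epochs, rounds and pairs; the pairs share the draw of a round, which is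
  -- harmless here.
  have hsub : {ω : Tape | ¬ ∀ k < K, ∀ i < 2 * N * m, ∀ j < D.numPairs,
      |D.error (1 / (4 * m) / 2 ^ k) ω (k * (2 * N * m))
        (D.epochs (1 / (4 * m)) (2 * N * m) ω k) i j| ≤ m * (1 / (4 * m) / 2 ^ k)} ⊆
      ⋃ x ∈ range K ×ˢ range (2 * N * m) ×ˢ range D.numPairs,
        {ω : Tape | m * (1 / (4 * m) / 2 ^ x.1) ≤
          |D.error (1 / (4 * m) / 2 ^ x.1) ω (x.1 * (2 * N * m))
            (D.epochs (1 / (4 * m)) (2 * N * m) ω x.1) x.2.1 x.2.2|} := by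
    intro ω hω
    simp only [Set.mem_ofPred_eq, not_forall, not_le] at hω
    obtain ⟨k, hk, i, hi, j, hj, hlt⟩ := hω
    simp only [Set.mem_iUnion, mem_product, mem_range]
    exact ⟨(k, i, j), ⟨hk, hi, hj⟩, hlt.le⟩
  refine (measure_mono hsub).trans ((measure_biUnion_finset_le _ _).trans ?_)
  refine (sum_le_card_nsmul _ _ (ENNReal.ofReal (2 * Real.exp (-c))) fun x hx => ?_).trans ?_
  · simp only [mem_product, mem_range] at hx
    have hmr : (0 : ℝ) < m := by exact_mod_cast hm
    refine (D.isBoundedMartingale_error (h := 1 / (4 * m) / 2 ^ x.1) (by positivity)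
      (x.1 * (2 * N * m)) (D.measurable_epochs (1 / (4 * m)) (2 * N * m) x.1)
      (fun ω ω' H => D.epochs_congr _ H) hx.2.2).measure_abs_ge_le (by positivity)
      hx.2.1.le (by positivity) ?_
    -- With `L = 2 * N * m`, the requirement `2 * c * L ≤ m ^ 2` is `4 * c * N * m ≤ m ^ 2`.
    nlinarith
  · rw [nsmul_eq_mul, card_product, card_product, card_range, card_range, card_range,
      ← ENNReal.ofReal_natCast, ← ENNReal.ofReal_mul (by positivity)]
    refine ENNReal.ofReal_le_ofReal (le_of_eq ?_)
    push_cast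
    ring

end TabularMDP

namespace RealRAM

@[simp] theorem State.writeNat_nat_of_ne (σ : State) {a b : ℕ} (h : b ≠ a) (i x : ℕ) :
    (σ.writeNat a i x).nat b = σ.nat b := by
  simp [State.writeNat, Function.update_of_ne h]

@[simp] theorem State.writeReal_real_of_ne (σ : State) {a b : ℕ} (h : b ≠ a) (i : ℕ) (x : ℝ) :
    (σ.writeReal a i x).real b = σ.real b := by
  simp [State.writeReal, Function.update_of_ne h]

/-- The rule for a linear sequence of a loop-free program and a program. -/
theorem Runs.of_wp_seq {ω : Tape} {p q : Prog} {σ : State} {T : ℕ} {R Q : State → Prop}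
    (h : p.wp ω R σ) (hq : ∀ σ', Frame p σ σ' → R σ' → Runs ω q σ' T Q) :
    Runs ω (p.seq q) σ (p.cost + T) Q :=
  Runs.seq ((Runs.of_wp h).mono le_rfl hq)

theorem Runs.seq' {ω : Tape} {p q : Prog} {σ : State} {T T' : ℕ} {R Q : State → Prop}
    (h : Runs ω p σ T R) (hq : ∀ σ', Frame p σ σ' → R σ' → Runs ω q σ' T' Q) :
    Runs ω (p.seq q) σ (T + T') Q :=
  Runs.seq (h.mono le_rfl hq)

end RealRAM

namespace ValueIteration

open RealRAM Finset

/-! ### The program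

Besides the input and the output, the memory holds
* the loop counters, in the natural-number arrays `5`, `6` and `7`;
* the bounds of a binary search, in the natural-number arrays `8` and `9`;
* the partial sums of the entries of the transition matrix, in the real array `4`;
* the estimated expected value of the next state for each pair, in the real array `5`;
* the change of the value of each state, in the real array `6`;
* the truncation width and the last random number, in the real arrays `7` and `8`;
* the parameters of the algorithm, in the real arrays `9`, `11`, `12` and `13`;
* temporary numbers, in the real arrays `10` and `14`. -/

/-- The number in cell `0` of an array of reals. -/
def scalar (a : ℕ) : RExp := .get a (.lit 0)

/-- The number `i` as a real. -/
def const (i : ℕ) : RExp := .ofNat (.lit i)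

/-- The size number `i` of the input. -/
def size (i : ℕ) : RExp := .ofNat (.get 0 (.lit i))

/-- The innermost loop counter. -/
def counter : NExp := .get 5 (.lit 0)

/-- The estimated total reward of a pair. -/
def qExp (j : NExp) : RExp := .add (.get 1 j) (.mul (.get 0 (.lit 0)) (.get 5 j))

/-- Computes the least positive integer that is at least `(1 - γ)⁻¹`. -/
def horizonProg : Prog :=
  .seq (.setReal 9 (.lit 0) (const 1))
    (.loop (.neg (.realLe (const 1) (.mul (scalar 9) (.sub (const 1) (scalar 0)))))
      (.setReal 9 (.lit 0) (.add (scalar 9) (const 1))))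

/-- Computes the least `n` for which `2 ^ n` is at least the number in array `14`. -/
def logProg (a : ℕ) : Prog :=
  .seq (.seq (.setReal a (.lit 0) (const 0)) (.setReal 10 (.lit 0) (const 1)))
    (.loop (.neg (.realLe (scalar 14) (scalar 10)))
      (.seq (.setReal 10 (.lit 0) (.add (scalar 10) (scalar 10)))
        (.setReal a (.lit 0) (.add (scalar a) (const 1)))))

/-- Computes the partial sums of the entries of the transition matrix. -/
def cumProg : Prog :=
  .seq (.setReal 10 (.lit 0) (const 0))
    (forLoop 5 (size 2)
      (.seq (.setReal 10 (.lit 0) (.add (scalar 10) (.get 2 counter)))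
        (.setReal 4 counter (scalar 10))))

/-- Computes the expected value of the next state for each pair. -/
def nextProg : Prog :=
  .seq (forLoop 5 (size 1) (.setReal 5 counter (const 0)))
    (forLoop 5 (size 2) (.setReal 5 (.get 2 counter)
      (.add (.get 5 (.get 2 counter)) (.mul (.get 2 counter) (.get 3 (.get 3 counter))))))

/-- Computes the truncated change of the value of each state. -/
def changeProg : Prog :=
  .seq (forLoop 5 (size 0) (.setReal 6 counter (.sub (const 0) (scalar 7))))
    (forLoop 5 (size 1)
      (.seq (.setReal 10 (.lit 0) (.sub (qExp counter) (.get 3 (.get 1 counter))))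
        (.seq (.ite (.realLe (scalar 7) (scalar 10)) (.setReal 10 (.lit 0) (scalar 7)) .skip)
          (.ite (.realLe (.get 6 (.get 1 counter)) (scalar 10))
            (.setReal 6 (.get 1 counter) (scalar 10)) .skip))))

/-- Adds the changes to the values. -/
def addProg : Prog :=
  forLoop 5 (size 0) (.setReal 3 counter (.add (.get 3 counter) (.get 6 counter)))

/-- The bisection of the entries for the row in `counter`. -/
def bisectProg : Prog :=
  .loop (.neg (.natLe (.get 9 (.lit 0)) (.get 8 (.lit 0))))
    (.ite (.realLe (.add (.ofNat counter) (scalar 8))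
        (.get 4 (.half (.add (.get 8 (.lit 0)) (.get 9 (.lit 0))))))
      (.setNat 9 (.lit 0) (.half (.add (.get 8 (.lit 0)) (.get 9 (.lit 0)))))
      (.setNat 8 (.lit 0) (.add (.half (.add (.get 8 (.lit 0)) (.get 9 (.lit 0)))) (.lit 1))))

/-- Updates the estimates with a sample for each pair. -/
def sampleProg : Prog :=
  forLoop 5 (size 1)
    (.seq (.seq (.setNat 8 (.lit 0) (.lit 0))
        (.setNat 9 (.lit 0) (.sub (.get 0 (.lit 2)) (.lit 1))))
      (.seq bisectProg
        (.setReal 5 counter (.add (.get 5 counter) (.get 6 (.get 3 (.get 8 (.lit 0))))))))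

/-- A round of value iteration. -/
def roundProg : Prog :=
  .seq changeProg (.seq addProg (.seq (.draw 8 (.lit 0)) sampleProg))

/-- An epoch. -/
def epochProg : Prog :=
  .seq nextProg (.seq (forLoop 6 (scalar 13) roundProg)
    (.setReal 7 (.lit 0) (.div (scalar 7) (const 2))))

/-- Computes a greedy policy. -/
def greedyProg : Prog :=
  .seq nextProg
    -- This pass gives every state a pair of its own, as the initial content `0` may name a pair of
    -- another state.
    (.seq (forLoop 5 (size 1) (.setNat 4 (.get 1 counter) counter))
      (forLoop 5 (size 1)
        (.ite (.realLe (qExp (.get 4 (.get 1 counter))) (qExp counter))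
          (.setNat 4 (.get 1 counter) counter) .skip)))

/-- Computes the parameters. -/
def paramProg : Prog :=
  .seq horizonProg
    (.seq (.setReal 14 (.lit 0)
        (.div (.mul (const 2) (.mul (scalar 9) (scalar 9))) (.get 0 (.lit 1))))
      (.seq (logProg 11)
        (.seq (.setReal 14 (.lit 0)
            (.div (.mul (.mul (const 32) (.add (scalar 11) (const 1)))
              (.mul (.mul (scalar 9) (scalar 9)) (size 1))) (.get 0 (.lit 2))))
          (.seq (logProg 12)
            -- With `m = 8 * N * c`: the number of rounds `2 * N * m = 16 * N ^ 2 * c`, and then the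
            -- first width `1 / (4 * m)`.
            (.seq (.setReal 13 (.lit 0)
                (.mul (const 16) (.mul (.mul (scalar 9) (scalar 9)) (scalar 12))))
              (.setReal 7 (.lit 0)
                (.div (const 1) (.mul (const 32) (.mul (scalar 9) (scalar 12))))))))))

/-- Truncated variance-reduced value iteration. -/
def mainProg : Prog :=
  .seq paramProg (.seq cumProg (.seq (forLoop 7 (scalar 11) epochProg) greedyProg))

/-! ### Correctness of the parts -/

/-- The memory holds the process `D`. -/
structure Loaded (D : TabularMDP) (σ : State) : Prop where
  numStates : σ.nat 0 0 = D.numStates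
  numPairs : σ.nat 0 1 = D.numPairs
  numEntries : σ.nat 0 2 = D.numEntries
  st : σ.nat 1 = D.st
  row : σ.nat 2 = D.row
  col : σ.nat 3 = D.col
  γ : σ.real 0 0 = D.γ
  r : σ.real 1 = D.r
  P : σ.real 2 = D.P

variable {D : TabularMDP} {ω : Tape} {σ σ' : State}

theorem Loaded.congr (h : Loaded D σ) (hn : ∀ a < 4, σ'.nat a = σ.nat a)
    (hr : ∀ a < 3, σ'.real a = σ.real a) : Loaded D σ' := by
  obtain ⟨h1, h2, h3, h4, h5, h6, h7, h8, h9⟩ := h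
  constructor <;> simp_all

theorem Loaded.frame {p : Prog} (h : Loaded D σ) (hF : Frame p σ σ')
    (hn : ∀ a < 4, p.writesNat a = false) (hr : ∀ a < 3, p.writesReal a = false) : Loaded D σ' :=
  h.congr (fun a ha => hF.nat a (hn a ha)) fun a ha => hF.real a (hr a ha)

theorem Loaded.writeNat (h : Loaded D σ) {a : ℕ} (ha : 4 ≤ a) (i x : ℕ) :
    Loaded D (σ.writeNat a i x) :=
  h.congr (fun b hb => σ.writeNat_nat_of_ne (by omega) i x) fun _ _ => rfl

theorem Loaded.writeReal (h : Loaded D σ) {a : ℕ} (ha : 3 ≤ a) (i : ℕ) (x : ℝ) :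
    Loaded D (σ.writeReal a i x) :=
  h.congr (fun _ _ => rfl) fun b hb => σ.writeReal_real_of_ne (by omega) i x

/-- A linear search is affordable, since the time budget contains a multiple of `(1 - γ)⁻¹ ^ 2`. It
starts at `1`, hence takes `N - 1` iterations. -/
theorem runs_horizonProg {N : ℕ} (hN : 0 < N) (hle : 1 ≤ N * (1 - σ.real 0 0))
    (hlt : ∀ n < N, (n : ℝ) * (1 - σ.real 0 0) < 1) :
    Runs ω horizonProg σ (20 * N + 20) fun σ' => σ'.real 9 0 = N := by
  have hN' : ((N - 1 : ℕ) : ℝ) + 1 = N := by exact_mod_cast Nat.sub_add_cancel hN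
  refine Runs.mono (Runs.of_wp_seq
    (R := fun σ' => σ'.real 9 0 = ((0 : ℕ) : ℝ) + 1 ∧ σ'.real 0 0 = σ.real 0 0) ?_
    fun σ₁ _ h₁ => Runs.loop
      (fun i σ' => σ'.real 9 0 = (i : ℝ) + 1 ∧ σ'.real 0 0 = σ.real 0 0)
      (N - 1) _ h₁ ?_ ?_ fun i hi σ₂ h₂ => Runs.of_wp ?_) ?_ ?_
  · simp [Prog.wp, RExp.eval, const, NExp.eval]
  · rintro i hi σ₂ ⟨h1, h2⟩
    have := hlt (i + 1) (by omega)
    push_cast at this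
    simpa [Test.Holds, RExp.eval, const, scalar, NExp.eval, h1, h2] using this
  · rintro σ₂ ⟨h1, h2⟩
    rw [hN'] at h1
    simpa [Test.Holds, RExp.eval, const, scalar, NExp.eval, h1, h2] using hle
  · simp [Prog.wp, RExp.eval, const, scalar, NExp.eval, h₂.1, h₂.2]
  · simp [Prog.cost, Test.cost, RExp.cost, NExp.cost, const, scalar]; omega
  · rintro σ₂ - ⟨h1, h2⟩
    rw [h1, hN']

theorem runs_logProg {a : ℕ} (ha : a ≠ 10) (ha' : a ≠ 14) {n : ℕ} (hle : σ.real 14 0 ≤ 2 ^ n)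
    (hlt : ∀ i < n, 2 ^ i < σ.real 14 0) :
    Runs ω (logProg a) σ (30 * n + 30) fun σ' => σ'.real a 0 = n := by
  refine Runs.mono (Runs.of_wp_seq
    (R := fun σ' => σ'.real a 0 = ((0 : ℕ) : ℝ) ∧ σ'.real 10 0 = 2 ^ 0 ∧
      σ'.real 14 0 = σ.real 14 0) ?_
    fun σ₁ _ h₁ => Runs.loop
      (fun i σ' => σ'.real a 0 = (i : ℝ) ∧ σ'.real 10 0 = 2 ^ i ∧ σ'.real 14 0 = σ.real 14 0)
      n _ h₁ ?_ ?_ fun i hi σ₂ h₂ => Runs.of_wp ?_) ?_ ?_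
  · simp [Prog.wp, RExp.eval, const, NExp.eval, ha, ha'.symm]
  · rintro i hi σ₂ ⟨-, h1, h2⟩
    simpa [Test.Holds, RExp.eval, scalar, NExp.eval, h1, h2] using hlt i hi
  · rintro σ₂ ⟨-, h1, h2⟩
    simpa [Test.Holds, RExp.eval, scalar, NExp.eval, h1, h2] using hle
  · simp [Prog.wp, RExp.eval, const, scalar, NExp.eval, ha, ha.symm, ha'.symm, h₂.1, h₂.2.1,
      h₂.2.2, pow_succ, mul_two]
  · simp [Prog.cost, Test.cost, RExp.cost, NExp.cost, const, scalar]; omega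
  · exact fun σ₂ _ h => h.1

theorem runs_cumProg (h : Loaded D σ) :
    Runs ω cumProg σ (40 * D.numEntries + 20)
      fun σ' => ∀ e < D.numEntries, σ'.real 4 e = D.cum e := by
  refine Runs.mono (Runs.of_wp_seq (R := fun σ' => σ'.real 10 0 = 0 ∧ Loaded D σ') ?_
    fun σ₁ _ h₁ => Runs.forLoop (fun i σ' => Loaded D σ' ∧
        σ'.real 10 0 = ∑ e ∈ range i, D.P e ∧ ∀ e < i, σ'.real 4 e = D.cum e)
      D.numEntries _ rfl ?_ ?_ fun i hi σ₂ h₂ hi₂ => Runs.of_wp ?_) ?_ ?_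
  · simp [Prog.wp, RExp.eval, const, NExp.eval, h.writeReal]
  · rintro i σ₂ ⟨h2, -⟩
    simp [size, RExp.eval, NExp.eval, h2.numEntries]
  · simp [h₁.1, h₁.2.writeNat]
  · obtain ⟨h2, h3, h4⟩ := h₂
    refine ⟨((h2.writeReal (by norm_num) _ _).writeReal (by norm_num) _ _).writeNat
      (by norm_num) _ _, ?_, ?_⟩
    · simp [RExp.eval, scalar, NExp.eval, counter, hi₂, h3, h2.P, sum_range_succ]
    · intro e he
      rcases Nat.lt_succ_iff_lt_or_eq.1 he with he | rfl
      · simp [RExp.eval, scalar, NExp.eval, counter, hi₂, he.ne, h4 e he]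
      · simp [RExp.eval, scalar, NExp.eval, counter, hi₂, h3, h2.P, TabularMDP.cum,
          sum_range_succ]
  · simp [Prog.cost, RExp.cost, NExp.cost, const, scalar, counter, size]; omega
  · exact fun σ₂ _ h => h.2.2

theorem runs_nextProg (h : Loaded D σ) :
    Runs ω nextProg σ (40 * D.numEntries + 40 * D.numPairs + 40)
      fun σ' => ∀ j < D.numPairs, σ'.real 5 j = D.next (σ.real 3) j := by
  refine Runs.mono (Runs.seq' (Runs.forLoop (fun i σ' => Loaded D σ' ∧
      σ'.real 3 = σ.real 3 ∧ ∀ j < i, σ'.real 5 j = 0) D.numPairs _ rfl ?_ ?_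
      fun i hi σ₂ h₂ hi₂ => Runs.of_wp ?_)
    fun σ₁ _ h₁ => Runs.forLoop (fun i σ' => Loaded D σ' ∧ σ'.real 3 = σ.real 3 ∧
        ∀ j < D.numPairs, σ'.real 5 j =
          ∑ e ∈ range i with D.row e = j, D.P e * σ.real 3 (D.col e))
      D.numEntries _ rfl ?_ ?_ fun i hi σ₂ h₂ hi₂ => Runs.of_wp ?_) ?_ ?_
  · rintro i σ₂ ⟨h2, -⟩
    simp [size, RExp.eval, NExp.eval, h2.numPairs]
  · simp [h.writeNat]
  · obtain ⟨h2, h3, h4⟩ := h₂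
    refine ⟨(h2.writeReal (by norm_num) _ _).writeNat (by norm_num) _ _, by simpa using h3,
      fun j hj => ?_⟩
    rcases Nat.lt_succ_iff_lt_or_eq.1 hj with hj | rfl
    · simp [NExp.eval, counter, hi₂, hj.ne, h4 j hj]
    · simp [RExp.eval, NExp.eval, counter, hi₂, const]
  · rintro i σ₂ ⟨h2, -⟩
    simp [size, RExp.eval, NExp.eval, h2.numEntries]
  · refine ⟨h₁.1.writeNat (by norm_num) _ _, by simpa using h₁.2.1, fun j hj => ?_⟩
    simp [h₁.2.2 j hj]
  · obtain ⟨h2, h3, h4⟩ := h₂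
    refine ⟨(h2.writeReal (by norm_num) _ _).writeNat (by norm_num) _ _, by simpa using h3,
      fun j hj => ?_⟩
    have hrow := h4 _ (D.row_lt i hi)
    rw [range_add_one, filter_insert]
    by_cases hij : D.row i = j
    · subst hij
      rw [if_pos rfl, sum_insert (by simp)]
      simp [RExp.eval, NExp.eval, counter, hi₂, h2.row, h2.col, h2.P, h3, hrow, add_comm]
    · rw [if_neg hij, ← h4 j hj]
      simp [RExp.eval, NExp.eval, counter, hi₂, h2.row, Ne.symm hij]
  · simp [Prog.cost, RExp.cost, NExp.cost, const, counter, size]; omega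
  · exact fun σ₂ _ h => h.2.2

theorem runs_changeProg (h : Loaded D σ) :
    Runs ω changeProg σ (60 * D.numStates + 60 * D.numPairs + 40)
      fun σ' => ∀ s < D.numStates, σ'.real 6 s =
        D.change (σ.real 7 0) (σ.real 3) (σ.real 5) s := by
  refine Runs.mono (Runs.seq' (Runs.forLoop (fun i σ' => Loaded D σ' ∧
      σ'.real 3 = σ.real 3 ∧ σ'.real 5 = σ.real 5 ∧ σ'.real 7 = σ.real 7 ∧
      ∀ s < i, σ'.real 6 s = - σ.real 7 0) D.numStates _ rfl ?_ ?_
      fun i hi σ₂ h₂ hi₂ => Runs.of_wp ?_)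
    fun σ₁ _ h₁ => Runs.forLoop (fun i σ' => Loaded D σ' ∧
        σ'.real 3 = σ.real 3 ∧ σ'.real 5 = σ.real 5 ∧ σ'.real 7 = σ.real 7 ∧
        ∀ s < D.numStates, σ'.real 6 s =
          (range i |>.filter fun j => D.st j = s).fold max (- σ.real 7 0) fun j =>
            min (σ.real 7 0) (D.r j + D.γ * σ.real 5 j - σ.real 3 s))
      D.numPairs _ rfl ?_ ?_ fun i hi σ₂ h₂ hi₂ => Runs.of_wp ?_) ?_ ?_
  · rintro i σ₂ ⟨h2, -⟩
    simp [size, RExp.eval, NExp.eval, h2.numStates]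
  · simp [h.writeNat]
  · obtain ⟨h2, h3, h4, h5, h6⟩ := h₂
    refine ⟨(h2.writeReal (by norm_num) _ _).writeNat (by norm_num) _ _, by simpa using h3,
      by simpa using h4, by simpa using h5, fun j hj => ?_⟩
    rcases Nat.lt_succ_iff_lt_or_eq.1 hj with hj | rfl
    · simp [RExp.eval, NExp.eval, counter, hi₂, hj.ne, h6 j hj]
    · simp [RExp.eval, NExp.eval, counter, hi₂, const, scalar, h5]
  · rintro i σ₂ ⟨h2, -⟩
    simp [size, RExp.eval, NExp.eval, h2.numPairs]
  · obtain ⟨h2, h3, h4, h5, h6⟩ := h₁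
    refine ⟨h2.writeNat (by norm_num) _ _, by simpa using h3, by simpa using h4,
      by simpa using h5, fun s hs => ?_⟩
    simp [h6 s hs]
  · obtain ⟨h2, h3, h4, h5, h6⟩ := h₂
    set b : ℝ := D.r i + D.γ * σ.real 5 i - σ.real 3 (D.st i) with hb
    -- The two conditionals have four outcomes, all of which amount to the same max-min update of
    -- array `6`; this proves the invariant once for all of them.
    have key : ∀ σ₃ : State, Loaded D σ₃ → σ₃.real 3 = σ.real 3 → σ₃.real 5 = σ.real 5 →
        σ₃.real 7 = σ.real 7 → (∀ s, σ₃.real 6 s =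
          if s = D.st i then max (min (σ.real 7 0) b) (σ₂.real 6 s) else σ₂.real 6 s) →
        Loaded D (σ₃.writeNat 5 0 (i + 1)) ∧ (σ₃.writeNat 5 0 (i + 1)).real 3 = σ.real 3 ∧
          (σ₃.writeNat 5 0 (i + 1)).real 5 = σ.real 5 ∧
          (σ₃.writeNat 5 0 (i + 1)).real 7 = σ.real 7 ∧
          ∀ s < D.numStates, (σ₃.writeNat 5 0 (i + 1)).real 6 s =
            (range (i + 1) |>.filter fun j => D.st j = s).fold max (- σ.real 7 0) fun j =>
              min (σ.real 7 0) (D.r j + D.γ * σ.real 5 j - σ.real 3 s) := by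
      intro σ₃ g1 g2 g3 g4 g5
      refine ⟨g1.writeNat (by norm_num) _ _, by simpa using g2, by simpa using g3,
        by simpa using g4, fun s hs => ?_⟩
      rw [State.writeNat_real, g5 s, range_add_one, filter_insert]
      by_cases his : D.st i = s
      · subst his
        rw [if_pos rfl, if_pos rfl, fold_insert (by simp), h6 _ hs]
      · rw [if_neg (Ne.symm his), if_neg his, h6 _ hs]
    have e1 : (RExp.sub (qExp counter) (.get 3 (.get 1 counter))).eval σ₂ = b := by
      simp [qExp, counter, RExp.eval, NExp.eval, hi₂, h2.r, h2.γ, h2.st, h3, h4, hb]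
    simp only [Prog.wp, e1]
    refine ⟨fun hc => ?_, fun hc => ?_⟩
    · have hc' : σ.real 7 0 ≤ b := by
        simpa [Test.Holds, RExp.eval, scalar, NExp.eval, h5] using hc
      refine ⟨fun hd => ?_, fun hd => ?_⟩
      · have hd' : σ₂.real 6 (D.st i) ≤ σ.real 7 0 := by
          simpa [Test.Holds, RExp.eval, scalar, NExp.eval, h5, counter, hi₂, h2.st] using hd
        refine key _ (((h2.writeReal (by norm_num) _ _).writeReal (by norm_num) _ _).writeReal
          (by norm_num) _ _) (by simpa using h3) (by simpa using h4) (by simpa using h5)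
          fun s => ?_
        by_cases hs : s = D.st i
        · subst hs
          simp [RExp.eval, scalar, NExp.eval, h5, counter, hi₂, h2.st, min_eq_left hc',
            max_eq_left hd']
        · simp [NExp.eval, counter, hi₂, h2.st, hs]
      · have hd' : σ.real 7 0 ≤ σ₂.real 6 (D.st i) := by
          have : σ.real 7 0 < σ₂.real 6 (D.st i) := by
            simpa [Test.Holds, RExp.eval, scalar, NExp.eval, h5, counter, hi₂, h2.st] using hd
          exact this.le
        refine key _ ((h2.writeReal (by norm_num) _ _).writeReal (by norm_num) _ _)
          (by simpa using h3) (by simpa using h4) (by simpa using h5) fun s => ?_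
        by_cases hs : s = D.st i
        · subst hs
          simp [min_eq_left hc', max_eq_right hd']
        · simp [hs]
    · have hc' : b ≤ σ.real 7 0 := by
        have : b < σ.real 7 0 := by
          simpa [Test.Holds, RExp.eval, scalar, NExp.eval, h5] using hc
        exact this.le
      refine ⟨fun hd => ?_, fun hd => ?_⟩
      · have hd' : σ₂.real 6 (D.st i) ≤ b := by
          simpa [Test.Holds, RExp.eval, scalar, NExp.eval, h5, counter, hi₂, h2.st] using hd
        refine key _ ((h2.writeReal (by norm_num) _ _).writeReal (by norm_num) _ _)
          (by simpa using h3) (by simpa using h4) (by simpa using h5) fun s => ?_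
        by_cases hs : s = D.st i
        · subst hs
          simp [RExp.eval, scalar, NExp.eval, counter, hi₂, h2.st, min_eq_right hc',
            max_eq_left hd']
        · simp [NExp.eval, counter, hi₂, h2.st, hs]
      · have hd' : b ≤ σ₂.real 6 (D.st i) := by
          have : b < σ₂.real 6 (D.st i) := by
            simpa [Test.Holds, RExp.eval, scalar, NExp.eval, h5, counter, hi₂, h2.st] using hd
          exact this.le
        refine key _ (h2.writeReal (by norm_num) _ _)
          (by simpa using h3) (by simpa using h4) (by simpa using h5) fun s => ?_
        by_cases hs : s = D.st i
        · subst hs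
          simp [min_eq_right hc', max_eq_right hd']
        · simp [hs]
  · simp [Prog.cost, Test.cost, RExp.cost, NExp.cost, const, counter, size, scalar, qExp]; omega
  · exact fun σ₂ _ h => h.2.2.2.2

theorem runs_addProg (h : Loaded D σ) :
    Runs ω addProg σ (40 * D.numStates + 20)
      fun σ' => ∀ s < D.numStates, σ'.real 3 s = σ.real 3 s + σ.real 6 s := by
  refine Runs.mono (Runs.forLoop (fun i σ' => Loaded D σ' ∧ σ'.real 6 = σ.real 6 ∧
      ∀ s, σ'.real 3 s = if s < i then σ.real 3 s + σ.real 6 s else σ.real 3 s)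
      D.numStates _ rfl ?_ ?_ fun i hi σ₂ h₂ hi₂ => Runs.of_wp ?_) ?_ ?_
  · rintro i σ₂ ⟨h2, -⟩
    simp [size, RExp.eval, NExp.eval, h2.numStates]
  · simp [h.writeNat]
  · obtain ⟨h2, h3, h4⟩ := h₂
    refine ⟨(h2.writeReal (by norm_num) _ _).writeNat (by norm_num) _ _, by simpa using h3,
      fun s => ?_⟩
    by_cases hs : s = i
    · subst hs
      simp [RExp.eval, NExp.eval, counter, hi₂, h3, h4]
    · have : s < i + 1 ↔ s < i := by omega
      simp [NExp.eval, counter, hi₂, hs, h4, this]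
  · simp [Prog.cost, RExp.cost, NExp.cost, counter, size]; omega
  · intro σ₂ _ h s hs
    rw [h.2.2, if_pos hs]

end ValueIteration

namespace RealRAM

/-- The rule for a loop that decreases a natural number in every iteration. -/
theorem Runs.loop_of_measure {ω : Tape} {b : Test} {p : Prog} {Q : State → Prop}
    (Inv : ℕ → State → Prop) (T : ℕ)
    (hstep : ∀ k σ, Inv k σ → (¬ b.Holds σ ∧ Q σ) ∨
      (b.Holds σ ∧ ∃ k', k = k' + 1 ∧ Runs ω p σ T (Inv k')))
    (k : ℕ) {σ : State} (hσ : Inv k σ) :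
    Runs ω (Prog.loop b p) σ (k * (b.cost + T) + b.cost) Q := by
  induction k generalizing σ with
  | zero =>
    rcases hstep 0 σ hσ with ⟨hb, hQ⟩ | ⟨-, k', hk', -⟩
    · exact ⟨_, σ, .loop_false hb, by simp, hQ⟩
    · omega
  | succ k ih =>
    rcases hstep _ σ hσ with ⟨hb, hQ⟩ | ⟨hb, k', hk', t, σ', he, ht, hσ'⟩
    · exact ⟨_, σ, .loop_false hb, by simp, hQ⟩
    · obtain rfl : k = k' := by omega
      obtain ⟨t', σ'', he', ht', hQ⟩ := ih hσ'
      refine ⟨_, σ'', .loop_true hb he he', ?_, hQ⟩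
      nlinarith

theorem Runs.of_le {ω : Tape} {p : Prog} {σ : State} {T T' : ℕ} {Q : State → Prop}
    (h : Runs ω p σ T Q) (hT : T ≤ T') : Runs ω p σ T' Q :=
  h.mono hT fun _ _ h => h

end RealRAM

namespace TabularMDP

variable (D : TabularMDP)

/-- The memory agrees with the mathematical vectors on valid indices only; this and `next_congr`
show that no other cells matter. -/
theorem change_congr {h : ℝ} {v v' x x' : ℕ → ℝ} {s : ℕ} (hv : v s = v' s)
    (hx : ∀ j < D.numPairs, x j = x' j) : D.change h v x s = D.change h v' x' s :=
  Finset.fold_congr fun j hj => by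
    rw [hv, hx j (Finset.mem_range.1 (Finset.mem_filter.1 hj).1)]

theorem next_congr {v v' : ℕ → ℝ} (hv : ∀ s < D.numStates, v s = v' s) (j : ℕ) :
    D.next v j = D.next v' j :=
  Finset.sum_congr rfl fun e he => by
    rw [hv _ (D.col_lt e (Finset.mem_range.1 (Finset.mem_filter.1 he).1))]

end TabularMDP

/-! ### Correctness of sampling, rounds, epochs and the whole program -/

namespace ValueIteration

open RealRAM Finset

variable {D : TabularMDP} {ω : Tape} {σ σ' : State}

theorem runs_bisectProg (hcum : ∀ e < D.numEntries, σ.real 4 e = D.cum e)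
    {j : ℕ} (hj : j < D.numPairs) (hσj : σ.nat 5 0 = j) (hu : σ.real 8 0 ≤ 1)
    (hlo : σ.nat 8 0 = 0) (hhi : σ.nat 9 0 = D.numEntries - 1) {g : ℕ}
    (hg : D.numEntries ≤ 2 ^ g) :
    Runs ω bisectProg σ (40 * g + 10) fun σ' => σ'.nat 8 0 = D.sample j (σ.real 8 0) := by
  have hE : 0 < D.numEntries := lt_of_le_of_lt (Nat.zero_le _) (D.sample_lt hj hu)
  have hjr : (j : ℝ) + 1 ≤ D.numPairs := by exact_mod_cast hj
  -- The sampled entry always lies between the two bounds, and the width of the bracket stays below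
  -- `2 ^ k`, where `k` bounds the iterations left.
  refine (Runs.loop_of_measure (fun k σ' => σ'.real = σ.real ∧ σ'.nat 5 0 = j ∧
    σ'.nat 8 0 ≤ σ'.nat 9 0 ∧ σ'.nat 9 0 < D.numEntries ∧ σ'.nat 9 0 - σ'.nat 8 0 < 2 ^ k ∧
    (∀ e < σ'.nat 8 0, D.cum e < j + σ.real 8 0) ∧ j + σ.real 8 0 ≤ D.cum (σ'.nat 9 0))
    34 ?_ g ?_).of_le ?_
  · rintro k σ' ⟨h1, h2, h3, h4, h5, h6, h7⟩
    by_cases hlt : σ'.nat 8 0 < σ'.nat 9 0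
    · right
      refine ⟨by simpa [Test.Holds, NExp.eval] using hlt, ?_⟩
      cases k with
      | zero => simp at h5; omega
      | succ k =>
        refine ⟨k, rfl, (Runs.of_wp ?_).of_le (by decide)⟩
        rw [pow_succ] at h5
        have hmid : (σ'.nat 8 0 + σ'.nat 9 0) / 2 < D.numEntries := by omega
        constructor
        · intro hb
          have hb' : j + σ.real 8 0 ≤ D.cum ((σ'.nat 8 0 + σ'.nat 9 0) / 2) := by
            rw [← hcum _ hmid]
            simpa [Test.Holds, RExp.eval, NExp.eval, counter, scalar, h1, h2] using hb
          simp only [Prog.wp, NExp.eval, State.writeNat_real, State.writeNat_nat]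
          norm_num
          exact ⟨h1, h2, by omega, hmid, by omega, h6, hb'⟩
        · intro hb
          have hb' : D.cum ((σ'.nat 8 0 + σ'.nat 9 0) / 2) < j + σ.real 8 0 := by
            rw [← hcum _ hmid]
            simpa [Test.Holds, RExp.eval, NExp.eval, counter, scalar, h1, h2] using hb
          simp only [Prog.wp, NExp.eval, State.writeNat_real, State.writeNat_nat]
          norm_num
          refine ⟨h1, h2, by omega, h4, by omega, fun e he => ?_, h7⟩
          exact (D.cum_mono (by omega) hmid).trans_lt hb'
    · left
      refine ⟨by simpa [Test.Holds, NExp.eval] using hlt, ?_⟩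
      have : σ'.nat 8 0 = σ'.nat 9 0 := by omega
      exact (D.sample_eq (this ▸ h4) h6 (this ▸ h7)).symm
  · refine ⟨rfl, hσj, by omega, by omega, by omega, by simp [hlo], ?_⟩
    rw [hhi, D.cum_last hE]
    linarith
  · simp only [Test.cost, NExp.cost]; omega

theorem runs_sampleProg (h : Loaded D σ) (hcum : ∀ e < D.numEntries, σ.real 4 e = D.cum e)
    (hu : σ.real 8 0 ≤ 1) {g : ℕ} (hg : D.numEntries ≤ 2 ^ g) :
    Runs ω sampleProg σ (D.numPairs * (40 * g + 80) + 20)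
      fun σ' => ∀ j < D.numPairs, σ'.real 5 j =
        σ.real 5 j + σ.real 6 (D.col (D.sample j (σ.real 8 0))) := by
  refine Runs.mono (Runs.forLoop (fun i σ' => Loaded D σ' ∧ σ'.real 4 = σ.real 4 ∧
      σ'.real 6 = σ.real 6 ∧ σ'.real 8 = σ.real 8 ∧ ∀ j, σ'.real 5 j =
        if j < i then σ.real 5 j + σ.real 6 (D.col (D.sample j (σ.real 8 0))) else σ.real 5 j)
      D.numPairs (9 + (40 * g + 10 + 12)) rfl ?_ ?_ fun i hi σ₂ h₂ hi₂ => ?_) ?_ ?_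
  · rintro i σ₂ ⟨h2, -⟩
    simp [size, RExp.eval, NExp.eval, h2.numPairs]
  · simp [h.writeNat]
  · obtain ⟨h2, h3, h4, h5, h6⟩ := h₂
    refine Runs.mono (Runs.of_wp_seq (R := fun σ' => Loaded D σ' ∧ σ'.real = σ₂.real ∧
        σ'.nat 5 0 = i ∧ σ'.nat 8 0 = 0 ∧ σ'.nat 9 0 = D.numEntries - 1) ?_
      fun σ₃ _ h₃ => Runs.seq' (runs_bisectProg ?_ hi h₃.2.2.1 ?_ h₃.2.2.2.1 h₃.2.2.2.2 hg)
        fun σ₄ hF₄ h₄ => Runs.of_wp ?_) ?_ fun _ _ h => h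
    · refine ⟨(h2.writeNat (by norm_num) _ _).writeNat (by norm_num) _ _, rfl, ?_⟩
      simp [NExp.eval, hi₂, h2.numEntries]
    · rw [h₃.2.1, h3]; exact hcum
    · rw [h₃.2.1, h5]; exact hu
    · have g1 : Loaded D σ₄ := h₃.1.frame hF₄ (by decide) (by decide)
      have g2 : ∀ a, σ₄.real a = σ₂.real a := fun a => by rw [hF₄.real a rfl, h₃.2.1]
      have g3 : σ₄.nat 5 0 = i := by rw [hF₄.nat 5 rfl, h₃.2.2.1]
      rw [h₃.2.1, h5] at h₄
      refine ⟨(g1.writeReal (by norm_num) _ _).writeNat (by norm_num) _ _, ?_, ?_, ?_,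
        fun j => ?_⟩
      · simpa [g2] using h3
      · simpa [g2] using h4
      · simpa [g2] using h5
      · by_cases hij : j = i
        · subst hij
          simp [RExp.eval, NExp.eval, counter, g3, g2, g1.col, h4, h₄, h6]
        · have : j < i + 1 ↔ j < i := by omega
          simp [NExp.eval, counter, g3, hij, g2, h6, this]
    · simp [Prog.cost, RExp.cost, NExp.cost, counter]
  · simp only [size, RExp.cost, NExp.cost]
    ring_nf; omega
  · intro σ₂ _ h j hj
    rw [h.2.2.2.2, if_pos hj]

/-- The memory between two rounds. -/
structure InRound (D : TabularMDP) (h : ℝ) (z : (ℕ → ℝ) × (ℕ → ℝ)) (σ : State) : Prop where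
  loaded : Loaded D σ
  cum : ∀ e < D.numEntries, σ.real 4 e = D.cum e
  width : σ.real 7 0 = h
  val : ∀ s < D.numStates, σ.real 3 s = z.1 s
  est : ∀ j < D.numPairs, σ.real 5 j = z.2 j

theorem InRound.writeNat {h : ℝ} {z : (ℕ → ℝ) × (ℕ → ℝ)} (H : InRound D h z σ) {a : ℕ}
    (ha : 4 ≤ a) (i x : ℕ) : InRound D h z (σ.writeNat a i x) :=
  ⟨H.loaded.writeNat ha i x, H.cum, H.width, H.val, H.est⟩

theorem runs_roundProg {h : ℝ} {z : (ℕ → ℝ) × (ℕ → ℝ)} (H : InRound D h z σ) {g : ℕ}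
    (hg : D.numEntries ≤ 2 ^ g) :
    Runs ω roundProg σ (100 * D.numStates + D.numPairs * (40 * g + 140) + 100)
      fun σ' => InRound D h (D.round h (ω σ.draws) z) σ' ∧ σ'.draws = σ.draws + 1 := by
  have hab : ∀ σ₁, Frame changeProg σ σ₁ → Loaded D σ₁ := fun σ₁ hF =>
    H.loaded.frame hF (by decide) (by decide)
  refine Runs.of_le (Runs.seq' (runs_changeProg H.loaded) fun σ₁ hF₁ h₁ =>
    Runs.seq' (runs_addProg (hab σ₁ hF₁)) fun σ₂ hF₂ h₂ =>
    Runs.of_wp_seq (R := fun σ' => (∀ a ≠ 8, σ'.real a = σ₂.real a) ∧ Loaded D σ' ∧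
      σ'.real 8 0 = ω σ.draws ∧ σ'.draws = σ.draws + 1) ?_
    fun σ₃ hF₃ h₃ => (runs_sampleProg h₃.2.1 ?_ ?_ hg).mono le_rfl fun σ₄ hF₄ h₄ => ?_) ?_
  · have hL : Loaded D σ₂ := (hab σ₁ hF₁).frame hF₂ (by decide) (by decide)
    have hd : σ₂.draws = σ.draws := by rw [hF₂.draws rfl, hF₁.draws rfl]
    refine ⟨fun a ha => ?_, hL.congr (fun _ _ => rfl) fun b hb => ?_, ?_, ?_⟩
    · exact σ₂.writeReal_real_of_ne ha _ _
    · exact σ₂.writeReal_real_of_ne (by omega) _ _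
    · simp [NExp.eval, hd]
    · simp [hd]
  · intro e he
    rw [h₃.1 4 (by norm_num), hF₂.real 4 rfl, hF₁.real 4 rfl, H.cum e he]
  · rw [h₃.2.2.1]; exact (ω σ.draws).2.2
  · have hd : ∀ s < D.numStates, σ₁.real 6 s = D.change h z.1 z.2 s := fun s hs => by
      rw [h₁ s hs, H.width, D.change_congr (H.val s hs) H.est]
    have e3 : σ₃.real 3 = σ₂.real 3 := h₃.1 3 (by norm_num)
    have e5 : σ₃.real 5 = σ.real 5 := by
      rw [h₃.1 5 (by norm_num), hF₂.real 5 rfl, hF₁.real 5 rfl]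
    have e6 : σ₃.real 6 = σ₁.real 6 := by rw [h₃.1 6 (by norm_num), hF₂.real 6 rfl]
    refine ⟨⟨h₃.2.1.frame hF₄ (by decide) (by decide), fun e he => ?_, ?_, fun s hs => ?_,
      fun j hj => ?_⟩, ?_⟩
    · rw [hF₄.real 4 rfl, h₃.1 4 (by norm_num), hF₂.real 4 rfl, hF₁.real 4 rfl, H.cum e he]
    · rw [hF₄.real 7 rfl, h₃.1 7 (by norm_num), hF₂.real 7 rfl, hF₁.real 7 rfl, H.width]
    · rw [hF₄.real 3 rfl, e3, h₂ s hs, hd s hs, hF₁.real 3 rfl, H.val s hs]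
      rfl
    · have hs := D.col_lt _ (D.sample_lt hj (ω σ.draws).2.2)
      rw [h₄ j hj, e5, e6, h₃.2.2.1, hd _ hs, H.est j hj]
      rfl
    · rw [hF₄.draws rfl, h₃.2.2.2]
  · simp only [Prog.cost, NExp.cost]; ring_nf; omega

/-- The memory between two epochs of `L` rounds. -/
structure InEpoch (D : TabularMDP) (h : ℝ) (L t : ℕ) (v : ℕ → ℝ) (σ : State) : Prop where
  loaded : Loaded D σ
  cum : ∀ e < D.numEntries, σ.real 4 e = D.cum e
  width : σ.real 7 0 = h
  length : σ.real 13 0 = L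
  draws : σ.draws = t
  val : ∀ s < D.numStates, σ.real 3 s = v s

theorem InEpoch.writeNat {h : ℝ} {L t : ℕ} {v : ℕ → ℝ} (H : InEpoch D h L t v σ) {a : ℕ}
    (ha : 4 ≤ a) (i x : ℕ) : InEpoch D h L t v (σ.writeNat a i x) :=
  ⟨H.loaded.writeNat ha i x, H.cum, H.width, H.length, H.draws, H.val⟩

theorem runs_epochProg {h : ℝ} {L t : ℕ} {v : ℕ → ℝ} (H : InEpoch D h L t v σ) {g : ℕ}
    (hg : D.numEntries ≤ 2 ^ g) :
    Runs ω epochProg σ (40 * D.numEntries + 40 * D.numPairs + 80 +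
        L * (100 * D.numStates + D.numPairs * (40 * g + 140) + 120))
      (InEpoch D (h / 2) L (t + L) (D.rounds h ω t v L).1) := by
  refine Runs.of_le (Runs.seq' (runs_nextProg H.loaded) fun σ₁ hF₁ h₁ =>
    Runs.seq' (Runs.forLoop (fun i σ' => InRound D h (D.rounds h ω t v i) σ' ∧
      σ'.draws = t + i ∧ σ'.real 13 0 = L) L _ rfl ?_ ?_ fun i hi σ₂ h₂ hi₂ =>
        (runs_roundProg h₂.1 hg).mono le_rfl fun σ₃ hF₃ h₃ => ?_)
    fun σ₂ hF₂ h₂ => Runs.of_wp ?_) ?_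
  · rintro i σ₂ ⟨-, -, h2⟩
    simpa [scalar, RExp.eval, NExp.eval] using h2
  · refine ⟨InRound.writeNat ⟨H.loaded.frame hF₁ (by decide) (by decide), fun e he => ?_, ?_,
      fun s hs => ?_, fun j hj => ?_⟩ (by norm_num) _ _, ?_, ?_⟩
    · rw [hF₁.real 4 rfl, H.cum e he]
    · rw [hF₁.real 7 rfl, H.width]
    · rw [hF₁.real 3 rfl, H.val s hs]; rfl
    · rw [h₁ j hj]; exact D.next_congr H.val j
    · simp [hF₁.draws rfl, H.draws]
    · simp [hF₁.real 13 rfl, H.length]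
  · rw [h₂.2.1] at h₃
    refine ⟨h₃.1.writeNat (by norm_num) _ _, ?_, ?_⟩
    · simp [h₃.2, add_assoc]
    · simp [hF₃.real 13 rfl, h₂.2.2]
  · refine ⟨h₂.1.loaded.writeReal (by norm_num) _ _, fun e he => ?_, ?_, ?_, ?_,
      fun s hs => ?_⟩
    · simpa using h₂.1.cum e he
    · simp [RExp.eval, NExp.eval, scalar, const, h₂.1.width]
    · simpa using h₂.2.2
    · simpa using h₂.2.1
    · simpa using h₂.1.val s hs
  · simp only [Prog.cost, NExp.cost, RExp.cost, scalar, const]; ring_nf; omega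

/-- The state-action pair number `j` is greedy for the values `v`. -/
def IsGreedy (D : TabularMDP) (v : ℕ → ℝ) (j : ℕ) : Prop :=
  ∀ i < D.numPairs, D.st i = D.st j →
    D.r i + D.γ * D.next v i ≤ D.r j + D.γ * D.next v j

/-- In the second pass, the pair stored for a state is at least as good as all pairs of that state
scanned so far. States are addressed through their pairs, so the lemma needs no assumption that
every state has one. -/
theorem runs_greedyProg (h : Loaded D σ) :
    Runs ω greedyProg σ (40 * D.numEntries + 160 * D.numPairs + 80)
      fun σ' => σ'.real 3 = σ.real 3 ∧ ∀ j < D.numPairs, σ'.nat 4 (D.st j) < D.numPairs ∧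
        D.st (σ'.nat 4 (D.st j)) = D.st j ∧ IsGreedy D (σ.real 3) (σ'.nat 4 (D.st j)) := by
  refine Runs.of_le (Runs.seq' (runs_nextProg h) fun σ₁ hF₁ h₁ =>
    Runs.seq' (Runs.forLoop (fun i σ' => Loaded D σ' ∧ σ'.real = σ₁.real ∧
      ∀ j < i, σ'.nat 4 (D.st j) < D.numPairs ∧ D.st (σ'.nat 4 (D.st j)) = D.st j)
        D.numPairs _ rfl ?_ ?_ fun i hi σ₂ h₂ hi₂ => Runs.of_wp ?_)
    fun σ₂ hF₂ h₂ => (Runs.forLoop (fun i σ' => Loaded D σ' ∧ σ'.real = σ₁.real ∧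
      ∀ j < D.numPairs, σ'.nat 4 (D.st j) < D.numPairs ∧ D.st (σ'.nat 4 (D.st j)) = D.st j ∧
        ∀ l < i, D.st l = D.st j → D.r l + D.γ * σ₁.real 5 l ≤
          D.r (σ'.nat 4 (D.st j)) + D.γ * σ₁.real 5 (σ'.nat 4 (D.st j)))
        D.numPairs _ rfl ?_ ?_ fun i hi σ₃ h₃ hi₃ => Runs.of_wp ?_).mono le_rfl
      fun σ₃ hF₃ h₃ => ?_) ?_
  · rintro i σ₂ ⟨h2, -⟩
    simp [size, RExp.eval, NExp.eval, h2.numPairs]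
  · simpa using (h.frame hF₁ (by decide) (by decide)).writeNat (by norm_num) _ _
  · obtain ⟨h2, h3, h4⟩ := h₂
    refine ⟨(h2.writeNat (by norm_num) _ _).writeNat (by norm_num) _ _, h3, fun j hj => ?_⟩
    by_cases hij : D.st j = D.st i
    · simp [NExp.eval, counter, hi₂, h2.st, hij, hi]
    · have : j < i := lt_of_le_of_ne (Nat.lt_succ_iff.1 hj) fun h => hij (h ▸ rfl)
      simpa [NExp.eval, counter, hi₂, h2.st, hij] using h4 j this
  · rintro i σ₂ ⟨h2, -⟩
    simp [size, RExp.eval, NExp.eval, h2.numPairs]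
  · refine ⟨h₂.1.writeNat (by norm_num) _ _, h₂.2.1, fun j hj => ?_⟩
    simpa using h₂.2.2 j hj
  · obtain ⟨h2, h3, h4⟩ := h₃
    obtain ⟨c1, c2, c3⟩ := h4 i hi
    constructor
    · intro hb
      have hb' : D.r (σ₃.nat 4 (D.st i)) + D.γ * σ₁.real 5 (σ₃.nat 4 (D.st i)) ≤
          D.r i + D.γ * σ₁.real 5 i := by
        rw [← h2.r, ← h2.γ, ← h3]
        simpa [Test.Holds, qExp, counter, RExp.eval, NExp.eval, hi₃, h2.st] using hb
      refine ⟨(h2.writeNat (by norm_num) _ _).writeNat (by norm_num) _ _, h3, fun j hj => ?_⟩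
      by_cases hij : D.st j = D.st i
      · simp only [State.writeNat_nat, NExp.eval, counter, hi₃, h2.st, hij]
        norm_num
        refine ⟨hi, fun l hl hls => ?_⟩
        rcases hl.lt_or_eq with hl | rfl
        · exact (c3 l hl hls).trans hb'
        · exact le_rfl
      · obtain ⟨d1, d2, d3⟩ := h4 j hj
        simp only [State.writeNat_nat, NExp.eval, counter, hi₃, h2.st, hij]
        norm_num
        refine ⟨d1, d2, fun l hl hls => ?_⟩
        rcases hl.lt_or_eq with hl | rfl
        · exact d3 l hl hls
        · exact absurd hls.symm hij
    · intro hb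
      have hb' : D.r i + D.γ * σ₁.real 5 i <
          D.r (σ₃.nat 4 (D.st i)) + D.γ * σ₁.real 5 (σ₃.nat 4 (D.st i)) := by
        rw [← h2.r, ← h2.γ, ← h3]
        simpa [Test.Holds, qExp, counter, RExp.eval, NExp.eval, hi₃, h2.st] using hb
      refine ⟨h2.writeNat (by norm_num) _ _, h3, fun j hj => ?_⟩
      obtain ⟨d1, d2, d3⟩ := h4 j hj
      simp only [State.writeNat_nat]
      norm_num
      refine ⟨d1, d2, fun l hl hls => ?_⟩
      rcases hl.lt_or_eq with hl | rfl
      · exact d3 l hl hls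
      · rw [← hls]; exact hb'.le
  · refine ⟨by rw [h₃.2.1, hF₁.real 3 rfl], fun j hj => ?_⟩
    obtain ⟨d1, d2, d3⟩ := h₃.2.2 j hj
    refine ⟨d1, d2, fun i hi his => ?_⟩
    rw [← h₁ i hi, ← h₁ _ d1]
    exact d3 i hi (his.trans d2)
  · simp only [Prog.cost, Test.cost, NExp.cost, RExp.cost, counter, qExp, size]; ring_nf; omega

/-- The numbers that the program computes first: an upper bound `N` of `(1 - γ)⁻¹`, the number `K`
of epochs, and the logarithmic factor `c` in the number of samples. -/
structure IsParam (D : TabularMDP) (ε δ : ℝ) (N K c : ℕ) : Prop where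
  horizon_pos : 0 < N
  le_horizon : 1 ≤ N * (1 - D.γ)
  horizon_lt : ∀ n < N, (n : ℝ) * (1 - D.γ) < 1
  le_epochs : 2 * (N * N) / ε ≤ (2 : ℝ) ^ K
  epochs_lt : ∀ i < K, (2 : ℝ) ^ i < 2 * (N * N) / ε
  le_logFactor : 32 * (K + 1) * ((N * N) * D.numPairs) / δ ≤ (2 : ℝ) ^ c
  logFactor_lt : ∀ i < c, (2 : ℝ) ^ i < 32 * (K + 1) * ((N * N) * D.numPairs) / δ

theorem runs_paramProg {ε δ : ℝ} (h : Loaded D σ) (hε : σ.real 0 1 = ε) (hδ : σ.real 0 2 = δ)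
    {N K c : ℕ} (H : IsParam D ε δ N K c) :
    Runs ω paramProg σ (20 * N + 30 * K + 30 * c + 200) fun σ' =>
      σ'.real 11 0 = K ∧ σ'.real 13 0 = (2 * N * (8 * N * c) : ℕ) ∧
        σ'.real 7 0 = 1 / (4 * (8 * N * c : ℕ)) := by
  have hγ := h.γ
  have hA := h.numPairs
  refine Runs.of_le (Runs.seq' (runs_horizonProg H.horizon_pos (hγ ▸ H.le_horizon)
    (hγ ▸ H.horizon_lt)) fun σ₁ hF₁ h₁ =>
    Runs.of_wp_seq (R := fun σ' => σ'.real 14 0 = 2 * (N * N) / ε) ?_ fun σ₂ hF₂ h₂ =>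
    Runs.seq' (runs_logProg (by norm_num) (by norm_num) (h₂ ▸ H.le_epochs)
      (h₂ ▸ H.epochs_lt)) fun σ₃ hF₃ h₃ =>
    Runs.of_wp_seq (R := fun σ' => σ'.real 14 0 = 32 * (K + 1) * ((N * N) * D.numPairs) / δ)
      ?_ fun σ₄ hF₄ h₄ =>
    Runs.seq' (runs_logProg (by norm_num) (by norm_num) (h₄ ▸ H.le_logFactor)
      (h₄ ▸ H.logFactor_lt)) fun σ₅ hF₅ h₅ => Runs.of_wp ?_) ?_
  · simp [Prog.wp, RExp.eval, NExp.eval, scalar, const, h₁, hF₁.real 0 rfl, hε]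
  · have e9 : σ₃.real 9 0 = N := by rw [hF₃.real 9 rfl, hF₂.real 9 rfl, h₁]
    have e0 : σ₃.real 0 2 = δ := by rw [hF₃.real 0 rfl, hF₂.real 0 rfl, hF₁.real 0 rfl, hδ]
    have n0 : σ₃.nat 0 1 = D.numPairs := by
      rw [hF₃.nat 0 rfl, hF₂.nat 0 rfl, hF₁.nat 0 rfl, hA]
    simp [Prog.wp, RExp.eval, NExp.eval, scalar, const, size, h₃, e9, e0, n0]
  · have e9 : σ₅.real 9 0 = N := by
      rw [hF₅.real 9 rfl, hF₄.real 9 rfl, hF₃.real 9 rfl, hF₂.real 9 rfl, h₁]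
    have e11 : σ₅.real 11 0 = K := by rw [hF₅.real 11 rfl, hF₄.real 11 rfl, h₃]
    refine ⟨?_, ?_, ?_⟩
    · simp [e11]
    · simp [RExp.eval, NExp.eval, scalar, const, e9, h₅]; ring
    · simp [RExp.eval, NExp.eval, scalar, const, e9, h₅]; ring
  · simp [Prog.cost, NExp.cost, RExp.cost, scalar, const, size]; ring_nf; omega

/-- The running time of the program. -/
def totalCost (D : TabularMDP) (g N K c : ℕ) : ℕ :=
  20 * N + 30 * K + 30 * c + 200 + (40 * D.numEntries + 20) +
    (K * (40 * D.numEntries + 40 * D.numPairs + 100 + 2 * N * (8 * N * c) *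
      (100 * D.numStates + D.numPairs * (40 * g + 140) + 120)) + 20) +
    (40 * D.numEntries + 160 * D.numPairs + 80)

/-- `v` is the actual content of array `3`. It agrees with `epochs` on the states, and the policy is
greedy for `v` itself. -/
theorem runs_mainProg {ε δ : ℝ} (h : Loaded D σ) (hε : σ.real 0 1 = ε) (hδ : σ.real 0 2 = δ)
    (hv : σ.real 3 = 0) (hd : σ.draws = 0) {N K c : ℕ} (H : IsParam D ε δ N K c) {g : ℕ}
    (hg : D.numEntries ≤ 2 ^ g) :
    Runs ω mainProg σ (totalCost D g N K c) fun σ' => ∃ v : ℕ → ℝ, σ'.real 3 = v ∧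
      (∀ s < D.numStates,
        v s = D.epochs (1 / (4 * (8 * N * c : ℕ))) (2 * N * (8 * N * c)) ω K s) ∧
      ∀ j < D.numPairs, σ'.nat 4 (D.st j) < D.numPairs ∧
        D.st (σ'.nat 4 (D.st j)) = D.st j ∧ IsGreedy D v (σ'.nat 4 (D.st j)) := by
  set L := 2 * N * (8 * N * c)
  set h₀ : ℝ := 1 / (4 * (8 * N * c : ℕ))
  refine Runs.of_le (Runs.seq' (runs_paramProg h hε hδ H) fun σ₁ hF₁ h₁ =>
    Runs.seq' (runs_cumProg (h.frame hF₁ (by decide) (by decide))) fun σ₂ hF₂ h₂ =>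
    Runs.seq' (Runs.forLoop (fun k σ' => InEpoch D (h₀ / 2 ^ k) L (k * L)
      (D.epochs h₀ L ω k) σ' ∧ σ'.real 11 0 = K) K _ rfl ?_ ?_ fun k hk σ₃ h₃ _ =>
        (runs_epochProg h₃.1 hg).mono le_rfl fun σ₄ hF₄ h₄ => ?_) fun σ₃ hF₃ h₃ =>
    (runs_greedyProg h₃.1.loaded).mono le_rfl fun σ₄ hF₄ h₄ => ?_) ?_
  · rintro i σ₂ ⟨-, h2⟩
    simpa [scalar, RExp.eval, NExp.eval] using h2
  · refine ⟨InEpoch.writeNat ⟨(h.frame hF₁ (by decide) (by decide)).frame hF₂ (by decide)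
      (by decide), h₂, ?_, ?_, ?_, fun s hs => ?_⟩ (by norm_num) _ _, ?_⟩
    · rw [hF₂.real 7 rfl, h₁.2.2, pow_zero, div_one]
    · rw [hF₂.real 13 rfl, h₁.2.1]
    · rw [hF₂.draws rfl, hF₁.draws rfl, hd]; simp
    · rw [hF₂.real 3 rfl, hF₁.real 3 rfl, hv]; rfl
    · rw [State.writeNat_real, hF₂.real 11 rfl, h₁.1]
  · refine ⟨?_, ?_⟩
    · rw [pow_succ, ← div_div, Nat.succ_mul]
      exact h₄.writeNat (by norm_num) _ _
    · rw [State.writeNat_real, hF₄.real 11 rfl, h₃.2]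
  · exact ⟨σ₃.real 3, h₄.1, h₃.1.val, h₄.2⟩
  · simp only [totalCost, RExp.cost, NExp.cost, scalar, L]; ring_nf; omega

end ValueIteration

namespace ValueIteration

open RealRAM Finset

/-! ### The parameters -/

/-- Minimality of `n` gives the strict bounds that the doubling loop needs, as well as the upper
bound on `2 ^ n` that keeps `n` logarithmic. -/
theorem exists_two_pow_ge (Z : ℝ) :
    ∃ n : ℕ, Z ≤ 2 ^ n ∧ (∀ i < n, (2 : ℝ) ^ i < Z) ∧ (2 : ℝ) ^ n ≤ max 1 (2 * Z) := by
  classical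
  have h : ∃ n : ℕ, Z ≤ 2 ^ n := pow_unbounded_of_one_lt Z one_lt_two |>.imp fun _ h => h.le
  have hlt : ∀ i < Nat.find h, (2 : ℝ) ^ i < Z := fun i hi => not_le.1 (Nat.find_min h hi)
  refine ⟨Nat.find h, Nat.find_spec h, hlt, ?_⟩
  rcases hn : Nat.find h with _ | n
  · simp
  · refine le_max_of_le_right ?_
    rw [pow_succ]
    linarith [hlt n (by omega)]

theorem exists_horizon {γ : ℝ} (h1 : γ < 1) :
    ∃ N : ℕ, 0 < N ∧ 1 ≤ N * (1 - γ) ∧ (∀ n < N, (n : ℝ) * (1 - γ) < 1) ∧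
      (N : ℝ) ≤ (1 - γ)⁻¹ + 1 := by
  classical
  have hpos : 0 < 1 - γ := by linarith
  have h : ∃ n : ℕ, 1 ≤ (n : ℝ) * (1 - γ) := by
    obtain ⟨n, hn⟩ := exists_nat_ge (1 - γ)⁻¹
    exact ⟨n, by rwa [inv_le_iff_one_le_mul₀ hpos] at hn⟩
  have hlt : ∀ i < Nat.find h, (i : ℝ) * (1 - γ) < 1 := fun i hi => not_le.1 (Nat.find_min h hi)
  have hN : 0 < Nat.find h := by
    refine Nat.pos_of_ne_zero fun h0 => ?_
    have := Nat.find_spec h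
    rw [h0] at this
    norm_num at this
  refine ⟨Nat.find h, hN, Nat.find_spec h, hlt, ?_⟩
  have h2 := hlt (Nat.find h - 1) (by omega)
  rw [← lt_div_iff₀ hpos, one_div, Nat.cast_sub hN] at h2
  push_cast at h2
  linarith

theorem natCast_le_of_two_pow_le {n p : ℕ} {Y : ℝ} (h : (2 : ℝ) ^ n ≤ Y ^ p) :
    (n : ℝ) ≤ 2 * p * Real.log Y := by
  have h1 := Real.log_le_log (by positivity) h
  rw [Real.log_pow, Real.log_pow] at h1
  -- Only `1 / 2 ≤ log 2` is used, whence the factor `2` in the claim.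
  have h2 : (n : ℝ) * (1 / 2) ≤ n * Real.log 2 :=
    mul_le_mul_of_nonneg_left (by linarith [Real.log_two_gt_d9]) (Nat.cast_nonneg n)
  linarith

/-- The dominant term is epochs times rounds times pairs times bisection depth, at most `8 * l * (16
* 4 * G ^ 2 * 22 * l) * (A * 600 * l)`; the three logarithms explain the exponent `3`. -/
theorem cost_arithmetic {A S E g N K c B G l : ℝ} (hA : 1 ≤ A) (hS : 0 ≤ S) (hSA : S ≤ A)
    (hE : 0 ≤ E) (hg0 : 0 ≤ g) (hN0 : 0 ≤ N) (hc0 : 0 ≤ c) (hG : 1 ≤ G)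
    (hl : 1 ≤ l) (hB : B = E + A * G ^ 2) (hN : N ≤ 2 * G) (hK : K ≤ 8 * l) (hc : c ≤ 22 * l)
    (hg : g ≤ 6 * l) :
    20 * N + 30 * K + 30 * c + 200 + (40 * E + 20) +
      (K * (40 * E + 40 * A + 100 + 2 * N * (8 * N * c) *
        (100 * S + A * (40 * g + 140) + 120)) + 20) + (40 * E + 160 * A + 80) ≤
      10000000 * B * l ^ 3 := by
  have hG2 : G ≤ G ^ 2 := by nlinarith
  have hG1 : 1 ≤ G ^ 2 := hG.trans hG2
  have hAB : A ≤ B := by rw [hB]; nlinarith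
  have hGB : G ^ 2 ≤ B := by rw [hB]; nlinarith
  have hEB : E ≤ B := by rw [hB]; nlinarith
  have hAGB : A * G ^ 2 ≤ B := by rw [hB]; linarith
  have hB1 : 1 ≤ B := hA.trans hAB
  have hl2 : l ≤ l ^ 2 := by nlinarith
  have hl3 : l ^ 2 ≤ l ^ 3 := by nlinarith [sq_nonneg l]
  have hBl : B ≤ B * l := le_mul_of_one_le_right (by linarith) hl
  have hBl2 : B * l ≤ B * l ^ 2 := mul_le_mul_of_nonneg_left hl2 (by linarith)
  have hBl3 : B * l ^ 2 ≤ B * l ^ 3 := mul_le_mul_of_nonneg_left hl3 (by linarith)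
  have hlB : l ≤ B * l := le_mul_of_one_le_left (by linarith) hB1
  have hN2 : N * N ≤ 4 * G ^ 2 := by
    have := mul_le_mul hN hN hN0 (by linarith)
    linarith
  have h1 : 100 * S + A * (40 * g + 140) + 120 ≤ A * (600 * l) := by
    have : A * (40 * g + 140) ≤ A * (380 * l) :=
      mul_le_mul_of_nonneg_left (by linarith) (by linarith)
    nlinarith
  have h2 : 2 * N * (8 * N * c) ≤ 16 * (4 * G ^ 2) * (22 * l) := by
    have := mul_le_mul hN2 hc hc0 (by positivity)
    linarith
  have h3 : 2 * N * (8 * N * c) * (100 * S + A * (40 * g + 140) + 120) ≤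
      844800 * (B * l ^ 2) := by
    have h4 := mul_le_mul h2 h1 (by positivity) (by positivity)
    have h5 : A * G ^ 2 * l ^ 2 ≤ B * l ^ 2 := mul_le_mul_of_nonneg_right hAGB (by positivity)
    linarith
  have h6 : 40 * E + 40 * A + 100 + 2 * N * (8 * N * c) *
      (100 * S + A * (40 * g + 140) + 120) ≤ 845000 * (B * l ^ 2) := by linarith
  have h7 := mul_le_mul hK h6 (by positivity) (by linarith)
  have h8 : 8 * l * (845000 * (B * l ^ 2)) = 6760000 * (B * l ^ 3) := by ring
  linarith

/-- The union bound carries the factor `c` from the number of rounds, so the tail `exp (-2c)` is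
split: one `exp (-c)` absorbs `c`, the other absorbs `32 * K * N ^ 2 * A / δ`. -/
theorem failure_arithmetic {A N K δ : ℝ} {c : ℕ} (hA : 0 ≤ A) (hδ : 0 < δ)
    (hc : 32 * (K + 1) * ((N * N) * A) / δ ≤ (2 : ℝ) ^ c) :
    K * (2 * N * (8 * N * c)) * A * (2 * Real.exp (-(2 * c : ℕ))) ≤ δ := by
  have h2 : (2 : ℝ) ^ c ≤ Real.exp c := by
    rw [← Real.exp_one_pow]
    exact pow_le_pow_left₀ (by norm_num) (by linarith [Real.add_one_le_exp (1 : ℝ)]) c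
  have h3 : (c : ℝ) ≤ Real.exp c := by linarith [Real.add_one_le_exp (c : ℝ)]
  have h4 : 32 * K * (N * N * A) ≤ δ * Real.exp c := by
    have h5 := (div_le_iff₀ hδ).1 (hc.trans h2)
    have : 0 ≤ N * N * A := mul_nonneg (mul_self_nonneg N) hA
    nlinarith
  have h6 : Real.exp (-(2 * c : ℕ)) = (Real.exp c)⁻¹ * (Real.exp c)⁻¹ := by
    rw [← Real.exp_neg, ← Real.exp_add]
    push_cast
    congr 1
    ring
  have h7 := mul_le_mul h4 h3 (Nat.cast_nonneg c) (by positivity)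
  rw [h6]
  calc _ = 32 * K * (N * N * A) * c * ((Real.exp c)⁻¹ * (Real.exp c)⁻¹) := by ring
    _ ≤ δ * Real.exp c * Real.exp c * ((Real.exp c)⁻¹ * (Real.exp c)⁻¹) :=
        mul_le_mul_of_nonneg_right h7 (by positivity)
    _ = δ := by
        have := (Real.exp_pos c).ne'
        field_simp

variable {S : Type} [Fintype S] {A : S → Type} [∀ s, Fintype (A s)] {M : DMDP S A}

theorem card_state_le [∀ s, Nonempty (A s)] : M.numStates ≤ M.numPairs :=
  Fintype.card_le_of_surjective (Sigma.fst : (Σ s, A s) → S) fun s =>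
    ⟨⟨s, Classical.arbitrary _⟩, rfl⟩

theorem nnz_le : M.nnz ≤ M.numPairs * M.numStates := by
  classical
  rw [DMDP.nnz, DMDP.numPairs, DMDP.numStates, ← Fintype.card_prod, ← Nat.card_eq_fintype_card]
  exact Nat.card_le_card_of_injective _ Subtype.val_injective

theorem two_pow_epochs_le {N K : ℕ} {Y ε : ℝ} (hε : 0 < ε⁻¹) (hY : 5 ≤ Y) (hN : N ≤ Y)
    (hεY : ε⁻¹ ≤ Y) (hK : (2 : ℝ) ^ K ≤ max 1 (2 * (2 * (N * N) / ε))) :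
    (2 : ℝ) ^ K ≤ Y ^ 4 := by
  refine hK.trans (max_le (one_le_pow₀ (by linarith)) ?_)
  rw [div_eq_mul_inv]
  have h1 : (N : ℝ) * N * ε⁻¹ ≤ Y * Y * Y := by gcongr
  have h2 : 4 * (Y * Y * Y) ≤ Y * (Y * Y * Y) :=
    mul_le_mul_of_nonneg_right (by linarith) (by positivity)
  calc 2 * (2 * ((N : ℝ) * N) * ε⁻¹) = 4 * (N * N * ε⁻¹) := by ring
    _ ≤ 4 * (Y * Y * Y) := by gcongr
    _ ≤ Y * (Y * Y * Y) := h2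
    _ = Y ^ 4 := by ring

/-- The eleven factors `Y` are three for the constant `64`, four for `K + 1 ≤ 2 ^ K`, three for `N ^
2 * A` and one for `δ⁻¹`. -/
theorem two_pow_logFactor_le {N K A c : ℕ} {Y δ : ℝ} (hδ : 0 < δ⁻¹) (hY : 5 ≤ Y) (hN : N ≤ Y)
    (hA : A ≤ Y) (hδY : δ⁻¹ ≤ Y) (hK : (2 : ℝ) ^ K ≤ Y ^ 4)
    (hc : (2 : ℝ) ^ c ≤ max 1 (2 * (32 * (K + 1) * ((N * N) * A) / δ))) :
    (2 : ℝ) ^ c ≤ Y ^ 11 := by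
  refine hc.trans (max_le (one_le_pow₀ (by linarith)) ?_)
  rw [div_eq_mul_inv]
  have hK' : (K : ℝ) + 1 ≤ Y ^ 4 := by
    refine le_trans ?_ hK
    exact_mod_cast Nat.lt_two_pow_self
  have h4 : (64 : ℝ) ≤ Y ^ 3 :=
    le_trans (by norm_num) (pow_le_pow_left₀ (by norm_num) hY 3)
  calc 2 * (32 * ((K : ℝ) + 1) * (N * N * A) * δ⁻¹)
      = 64 * (((K : ℝ) + 1) * (N * N * A) * δ⁻¹) := by ring
    _ ≤ Y ^ 3 * (Y ^ 4 * (Y * Y * Y) * Y) := by gcongr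
    _ = Y ^ 11 := by ring

theorem two_pow_depth_le {E A S g : ℕ} {Y : ℝ} (hY : 5 ≤ Y) (hE : E ≤ A * S) (hSA : S ≤ A)
    (hA : A ≤ Y) (hg : (2 : ℝ) ^ g ≤ max 1 (2 * (E : ℝ))) : (2 : ℝ) ^ g ≤ Y ^ 3 := by
  refine hg.trans (max_le (one_le_pow₀ (by linarith)) ?_)
  have hE' : (E : ℝ) ≤ A * S := by exact_mod_cast hE
  have hS : (S : ℝ) ≤ Y := le_trans (by exact_mod_cast hSA) hA
  calc 2 * (E : ℝ) ≤ 2 * (A * S) := by gcongr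
    _ ≤ Y * (Y * Y) := by gcongr; linarith
    _ = Y ^ 3 := by ring

/-- Needed for `m = 8 * N * c` to be positive; `c = 0` would force `δ ≥ 1`. -/
theorem logFactor_pos {N K A c : ℕ} {δ : ℝ} (hN : 0 < N) (hA : 0 < A) (hδ : 0 < δ) (hδ1 : δ < 1)
    (hc : 32 * (K + 1) * ((N * N) * A) / δ ≤ (2 : ℝ) ^ c) : 0 < c := by
  refine Nat.pos_of_ne_zero fun h0 => ?_
  rw [h0, pow_zero, div_le_one hδ] at hc
  have : (1 : ℝ) ≤ 32 * (K + 1) * ((N * N) * A) := by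
    exact_mod_cast Nat.succ_le_of_lt (show 0 < 32 * (K + 1) * ((N * N) * A) by positivity)
  linarith

/-- There are parameters of the size that the analysis requires. -/
theorem exists_isParam [Nonempty S] [∀ s, Nonempty (A s)] (I : M.Numbering) {ε δ : ℝ}
    (hε : 0 < ε) (hδ : 0 < δ) (hδ1 : δ < 1) :
    ∃ N K c g : ℕ, IsParam I.toTabular ε δ N K c ∧ 0 < c ∧ M.nnz ≤ 2 ^ g ∧
      (totalCost I.toTabular g N K c : ℝ) ≤
        10000000 * ((M.nnz : ℝ) + (M.numPairs : ℝ) * (1 - M.γ)⁻¹ ^ 2) *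
          Real.log (2 + (M.numPairs : ℝ) + ε⁻¹ + (1 - M.γ)⁻¹ + δ⁻¹) ^ 3 := by
  obtain ⟨N, hN0, hN1, hN2, hN3⟩ := exists_horizon M.γ_lt_one
  obtain ⟨K, hK1, hK2, hK3⟩ := exists_two_pow_ge (2 * (N * N) / ε)
  obtain ⟨c, hc1, hc2, hc3⟩ :=
    exists_two_pow_ge (32 * (K + 1) * ((N * N) * M.numPairs) / δ)
  obtain ⟨g, hg1, -, hg3⟩ := exists_two_pow_ge M.nnz
  have hS0 : 0 < M.numStates := Fintype.card_pos
  have hSA : M.numStates ≤ M.numPairs := card_state_le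
  have hE : M.nnz ≤ M.numPairs * M.numStates := nnz_le
  have hA : (1 : ℝ) ≤ M.numPairs := by exact_mod_cast hS0.trans_le hSA
  have hc0 := logFactor_pos hN0 (hS0.trans_le hSA) hδ hδ1 hc1
  refine ⟨N, K, c, g, ⟨hN0, hN1, hN2, hK1, hK2, hc1, hc2⟩, hc0, by exact_mod_cast hg1, ?_⟩
  have hG1 : 1 ≤ (1 - M.γ)⁻¹ :=
    (one_le_inv₀ (by linarith [M.γ_lt_one])).2 (by linarith [M.γ_nonneg])
  have hcost : (totalCost I.toTabular g N K c : ℝ) =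
      20 * N + 30 * K + 30 * c + 200 + (40 * M.nnz + 20) +
      (K * (40 * M.nnz + 40 * M.numPairs + 100 + 2 * N * (8 * N * c) *
        (100 * M.numStates + M.numPairs * (40 * g + 140) + 120)) + 20) +
      (40 * M.nnz + 160 * M.numPairs + 80) := by
    change ((20 * N + 30 * K + 30 * c + 200 + (40 * M.nnz + 20) +
      (K * (40 * M.nnz + 40 * M.numPairs + 100 + 2 * N * (8 * N * c) *
        (100 * M.numStates + M.numPairs * (40 * g + 140) + 120)) + 20) +
      (40 * M.nnz + 160 * M.numPairs + 80) : ℕ) : ℝ) = _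
    push_cast
    rfl
  rw [hcost]
  clear hcost hN1 hN2 hK1 hK2 hc1 hc2 hg1
  have hSA' : (M.numStates : ℝ) ≤ M.numPairs := by exact_mod_cast hSA
  generalize M.numStates = nS at *
  generalize M.numPairs = nA at *
  generalize M.nnz = nE at *
  generalize (1 - M.γ)⁻¹ = G at *
  have hε' : 0 < ε⁻¹ := inv_pos.2 hε
  have hδ' : 1 < δ⁻¹ := (one_lt_inv₀ hδ).2 hδ1
  obtain ⟨Y, hY⟩ : ∃ Y, Y = 2 + (nA : ℝ) + ε⁻¹ + G + δ⁻¹ := ⟨_, rfl⟩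
  rw [← hY]
  -- Here `2 + 1 + 0 + 1 + 1` bounds the summands from below; `Y ≥ 5 > e` makes the logarithm at
  -- least `1`.
  have hY5 : 5 ≤ Y := by linarith
  have hl : 1 ≤ Real.log Y := by
    rw [Real.le_log_iff_exp_le (by linarith)]
    linarith [Real.exp_one_lt_d9]
  have hK4 := two_pow_epochs_le hε' hY5 (by linarith) (by linarith) hK3
  have h1 := natCast_le_of_two_pow_le hK4
  have h2 := natCast_le_of_two_pow_le
    (two_pow_logFactor_le (by linarith) hY5 (by linarith) (by linarith) (by linarith) hK4 hc3)
  have h3 := natCast_le_of_two_pow_le (two_pow_depth_le hY5 hE hSA (by linarith) hg3)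
  push_cast at h1 h2 h3
  exact cost_arithmetic hA (Nat.cast_nonneg _) hSA' (Nat.cast_nonneg _) (Nat.cast_nonneg _)
    (Nat.cast_nonneg _) (Nat.cast_nonneg _) hG1 hl rfl (by linarith) (by linarith)
    (by linarith) (by linarith)

/-! ### Input and output -/

theorem loaded_input (I : M.Numbering) (ε δ : ℝ) : Loaded I.toTabular (I.input ε δ) where
  numStates := rfl
  numPairs := rfl
  numEntries := rfl
  st := rfl
  row := rfl
  col := rfl
  γ := rfl
  r := rfl
  P := rfl

theorem exists_greedy_action (I : M.Numbering) {v : ℕ → ℝ} {s : S} {j : ℕ} (hj : j < M.numPairs)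
    (hs : I.st j = I.state.symm s) (hg : IsGreedy I.toTabular v j) :
    ∃ a : A s, j = I.pair.symm ⟨s, a⟩ ∧
      ∀ a', M.qValue (fun s => v (I.state.symm s)) ⟨s, a'⟩ ≤
        M.qValue (fun s => v (I.state.symm s)) ⟨s, a⟩ := by
  obtain ⟨⟨s', a⟩, hq⟩ : ∃ q, I.pair ⟨j, hj⟩ = q := ⟨_, rfl⟩
  have hs' : s' = s := by
    rw [DMDP.Numbering.st, dif_pos hj, hq] at hs
    exact I.state.symm.injective (Fin.ext hs)
  subst hs'
  refine ⟨a, by rw [← hq, Equiv.symm_apply_apply], fun a' => ?_⟩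
  have hj' : I.st (I.pair.symm ⟨s', a'⟩) = I.st j := by
    rw [hs]; simp [DMDP.Numbering.st]
  have h := hg _ (I.pair.symm ⟨s', a'⟩).2 hj'
  rw [I.qValue_eq v hj, I.qValue_eq v (I.pair.symm ⟨s', a'⟩).2, hq] at h
  simpa using h

theorem isEpsOptimalOutput [∀ s, Nonempty (A s)] (I : M.Numbering) {ε α : ℝ} {v : ℕ → ℝ}
    {σ : State} (hε : α ≤ ε) (hα : 2 * α ≤ ε * (1 - M.γ)) (hσ : σ.real 3 = v)
    (hv : ∀ s < M.numStates, |v s - I.tabulate M.optValue s| ≤ α) (hε0 : 0 ≤ ε)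
    (hpol : ∀ j < M.numPairs, σ.nat 4 (I.st j) < M.numPairs ∧
      I.st (σ.nat 4 (I.st j)) = I.st j ∧ IsGreedy I.toTabular v (σ.nat 4 (I.st j))) :
    I.IsEpsOptimalOutput ε σ := by
  have hv' : ∀ s, |v (I.state.symm s) - M.optValue s| ≤ α := fun s => by
    have := hv _ (I.state.symm s).2
    rwa [I.tabulate_symm] at this
  have H : ∀ s, ∃ a : A s, σ.nat 4 (I.state.symm s) = I.pair.symm ⟨s, a⟩ ∧
      ∀ a', M.qValue (fun s => v (I.state.symm s)) ⟨s, a'⟩ ≤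
        M.qValue (fun s => v (I.state.symm s)) ⟨s, a⟩ := fun s => by
    -- Any action of `s` gives a pair through which the cell of `s` is reached.
    have hst : I.st (I.pair.symm ⟨s, Classical.arbitrary _⟩) = I.state.symm s := by
      simp [DMDP.Numbering.st]
    have h := hpol _ (I.pair.symm ⟨s, Classical.arbitrary _⟩).2
    rw [hst] at h
    exact exists_greedy_action I h.1 h.2.1 h.2.2
  choose π hπ hgr using H
  refine ⟨⟨π, M.isEpsOptimalPolicy_of_greedy hv' hα π hgr, hπ⟩, ?_⟩
  refine (pi_norm_le_iff_of_nonneg hε0).2 fun s => ?_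
  rw [Pi.sub_apply, Real.norm_eq_abs, hσ]
  exact (hv' s).trans hε

end ValueIteration

/-! ### Assembly of the main theorem -/

open ValueIteration RealRAM in
theorem theorem1p2 :
    ∃ (p : RealRAM.Prog) (C : ℝ) (k : ℕ),
      ∀ (S : Type) [Fintype S] [Nonempty S] (A : S → Type) [∀ s, Fintype (A s)]
        [∀ s, Nonempty (A s)] (M : DMDP S A) (I : M.Numbering) (ε δ : ℝ),
        0 < ε → 0 < δ → δ < 1 →
        (∀ ω : RealRAM.Tape, ∃ (t : ℕ) (σ : RealRAM.State),
          RealRAM.Exec ω p (I.input ε δ) t σ ∧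
          (t : ℝ) ≤ C * ((M.nnz : ℝ) + (M.numPairs : ℝ) * (1 - M.γ)⁻¹ ^ 2) *
            Real.log (2 + (M.numPairs : ℝ) + ε⁻¹ + (1 - M.γ)⁻¹ + δ⁻¹) ^ k) ∧
        RealRAM.tapeMeasure {ω | ¬ ∃ (t : ℕ) (σ : RealRAM.State),
          RealRAM.Exec ω p (I.input ε δ) t σ ∧ I.IsEpsOptimalOutput ε σ} ≤ ENNReal.ofReal δ := by
  refine ⟨mainProg, 10000000, 3, ?_⟩
  intro S _ _ A _ _ M I ε δ hε hδ hδ1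
  obtain ⟨N, K, c, g, H, hc, hg, hcost⟩ := exists_isParam I hε hδ hδ1
  have hrun := fun ω : Tape => runs_mainProg (ω := ω) (loaded_input I ε δ) (ε := ε) (δ := δ) rfl
    rfl rfl rfl H hg
  have hNr : (1 : ℝ) ≤ N := by exact_mod_cast H.horizon_pos
  have hm : 0 < 8 * N * c := Nat.mul_pos (Nat.mul_pos (by norm_num) H.horizon_pos) hc
  refine ⟨fun ω => ?_, ?_⟩
  · obtain ⟨t, σ, he, ht, -⟩ := hrun ω
    exact ⟨t, σ, he, le_trans (by exact_mod_cast ht) hcost⟩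
  -- Tapes with a bad output lie among those with an inaccurate estimate; monotonicity of the outer
  -- measure needs no measurability. The exponent is `2 * c`, for which `4 * (2 * c) * N` is exactly
  -- `m`.
  · refine le_trans (measure_mono ?_) ((I.toTabular.measure_error_le (N := N) (m := 8 * N * c)
      (c := 2 * c) (K := K) H.horizon_pos hm (by nlinarith)).trans (ENNReal.ofReal_le_ofReal ?_))
    · intro ω hω
      rw [Set.mem_ofPred_eq] at hω ⊢
      intro hgood
      refine hω ?_
      obtain ⟨t, σ, he, -, v, hσv, hv, hpol⟩ := hrun ω
      have hγ : (0 : ℝ) < 1 - M.γ := by linarith [M.γ_lt_one]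
      have hγN : 1 / (1 - M.γ) ≤ N := by
        rw [div_le_iff₀ hγ]; exact H.le_horizon
      have h2K := H.le_epochs
      rw [div_le_iff₀ hε] at h2K
      have hpow : (0 : ℝ) < 2 ^ K := by positivity
      -- The choice of `K` yields `2 * N * α ≤ ε` for `α = N / 2 ^ K`. With `1 ≤ N` this bounds the
      -- values' error, and with `1 ≤ N * (1 - γ)` it gives `2 * α ≤ ε * (1 - γ)` for the policy.
      have hα : (N : ℝ) / 2 ^ K * (2 * N) ≤ ε := by
        rw [div_mul_eq_mul_div, div_le_iff₀ hpow]
        linarith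
      have hα0 : (0 : ℝ) ≤ N / 2 ^ K := by positivity
      refine ⟨t, σ, he, isEpsOptimalOutput I (α := N / 2 ^ K) (by nlinarith) ?_ hσv ?_ hε.le hpol⟩
      · have h1 : (N : ℝ) / 2 ^ K * (2 * N) * (1 - M.γ) ≤ ε * (1 - M.γ) :=
          mul_le_mul_of_nonneg_right hα hγ.le
        have h2 : (1 : ℝ) ≤ N * (1 - M.γ) := H.le_horizon
        nlinarith
      · intro s hs
        rw [hv s hs]
        refine I.toTabular.abs_epochs_sub_le I.isOptimal_tabulate H.horizon_pos hm H.le_horizon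
          (fun s hs => ?_) ω K hgood hs
        have : I.tabulate M.optValue s = M.optValue (I.state ⟨s, hs⟩) := dif_pos hs
        rw [this, abs_of_nonneg (M.optValue_nonneg _)]
        exact (M.optValue_le _).trans hγN
    · have h := failure_arithmetic (A := M.numPairs) (N := N) (K := K) (Nat.cast_nonneg _)
        hδ H.le_logFactor
      refine le_trans (le_of_eq ?_) h
      push_cast
      rfl
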